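/- **Setting.** A network has agents $1,\dots,N$ joined by an undirected graph. Agent $k$ has a cost $J_k:\mathbb{R}^M\to\mathbb{R}$ with minimizer $w_k^o$; two agents belong to the same cluster iff their minimizers coincide. The agents are partitioned into groups $\mathcal G_1,\dots,\mathcal G_G$; each group is a nonempty connected set of agents of one cluster. $\|\cdot\|$ is the Euclidean norm of vectors and the induced 2-norm of matrices, $\mathrm{col}\{\cdot\}$ stacks vectors, $\mathcal W=\mathrm{col}\{w_1,\dots,w_N\}\in\mathbb{R}^{NM}$, and $\mathcal W^o=\mathrm{col}\{w_1^o,\dots,w_N^o\}$. *Costs.* Each $J_k$ is strictly convex and twice differentiable with $\lambda_{k,L}I\le\nabla^2J_k(w)\le\lambda_{k,U}I$ for all $w$, where $0\le\lambda_{k,L}\le\lambda_{k,U}<\infty$; every group contains an agent $k$ with $\lambda_{k,L}>0$; and $\nabla^2J(\mathcal W)=\mathrm{diag}\{\nabla^2J_k(w_k)\}_{k=1}^N$ satisfies $\|\nabla^2J(\mathcal W_1)-\nabla^2J(\mathcal W_2)\|\le\kappa_H\|\mathcal W_1-\mathcal W_2\|$ for all $\mathcal W_1,\mathcal W_2$.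 *Combination weights.* $A=[a_{\ell k}]$ with $a_{\ell k}>0$ if $\ell$ and $k$ lie in the same group and $\ell$ is $k$ or a neighbour of $k$, $a_{\ell k}=0$ otherwise, and $\sum_\ell a_{\ell k}=1$ for all $k$. Put $\mathcal A=A\otimes I_M$. *Recursions.* Given step-sizes $\mu_k>0$, let $\mu_{\max}=\max_k\mu_k$ and $\mathcal M=\mathrm{diag}\{\mu_1,\dots,\mu_N\}\otimes I_M$. Let $\hat g_{k,i}(w)$ be the random approximation of $\nabla J_k(w)$ used by agent $k$ at iteration $i\ge1$. Starting from a random $\mathcal W_0$, the adapt-then-combine iterates $\mathcal W_i=\mathrm{col}\{w_{1,i},\dots,w_{N,i}\}$ are $$w_{k,i}=\sum_{\ell}a_{\ell k}\bigl(w_{\ell,i-1}-\mu_\ell\,\hat g_{\ell,i}(w_{\ell,i-1})\bigr).$$ The gradient noise is $\mathcal S_i(\mathcal W)=\mathrm{col}\{\hat g_{k,i}(w_k)-\nabla J_k(w_k)\}_{k=1}^N$. The network error is $\widetilde{\mathcal W}_i=\mathcal W^o-\mathcal W_i$; equivalently, it evolves by the nonlinear error recursion $$\widetilde{\mathcal W}_i=\mathcal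 A^{\mathsf T}(I-\mathcal M\mathcal H_{i-1})\widetilde{\mathcal W}_{i-1}+\mathcal A^{\mathsf T}\mathcal M\,\mathcal S_i(\mathcal W_{i-1}),\qquad \mathcal H_{i-1}=\int_0^1\nabla^2J(\mathcal W^o-t\widetilde{\mathcal W}_{i-1})\,dt.$$ The long-term model, started at a random $\widetilde{\mathcal W}_0^{\rm long}$, is $$\widetilde{\mathcal W}_i^{\rm long}=\mathcal A^{\mathsf T}(I-\mathcal M\mathcal H)\widetilde{\mathcal W}_{i-1}^{\rm long}+\mathcal A^{\mathsf T}\mathcal M\,\mathcal S_i(\mathcal W_{i-1}),\qquad\mathcal H=\nabla^2J(\mathcal W^o).$$ *Gradient noise.* On a probability space with a filtration $(\mathbb F_i)_{i\ge0}$, for every $i\ge1$ and every $\mathbb F_{i-1}$-measurable random $\mathcal W$, $\mathcal S_i(\mathcal W)$ is $\mathbb F_i$-measurable; and if moreover $\mathbb E\|\mathcal W\|^4<\infty$, then $\mathbb E\|\mathcal S_i(\mathcal W)\|^4<\infty$ and, almost surely, $$\mathbb E[\mathcal S_i(\mathcal W)\mid\mathbb F_{i-1}]=0,\qquad \mathbb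 E[\|\mathcal S_i(\mathcal W)\|^4\mid\mathbb F_{i-1}]\le\alpha^2\|\mathcal W^o-\mathcal W\|^4+\sigma_s^4$$ with constants $\alpha,\sigma_s\ge0$. **Lemma (Accuracy of long-term model).** Fix the graph, the groups, the costs, $A$, $\alpha$, $\sigma_s$ and a number $\tau>0$. There are $\mu_0>0$ and $C\ge0$ such that for all step-sizes with $\mu_k>0$ and $\mu_k\ge\tau\mu_{\max}$ for every $k$ and $\mu_{\max}\le\mu_0$, for every gradient noise process as above, every $\mathbb F_0$-measurable $\mathcal W_0$ with $\mathbb E\|\mathcal W_0\|^4<\infty$, and every $\widetilde{\mathcal W}_0^{\rm long}$ with $\mathbb E\|\widetilde{\mathcal W}_0^{\rm long}\|^2<\infty$, $$\limsup_{i\to\infty}\ \mathbb E\bigl\|\widetilde{\mathcal W}_i-\widetilde{\mathcal W}_i^{\rm long}\bigr\|^2\le C\,\mu_{\max}^2 .$$ -/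

import Mathlib

open MeasureTheory ProbabilityTheory Filter Topology
open scoped ENNReal NNReal

namespace MultitaskDiffusion

noncomputable section

/-- The parameter space `ℝ^M` of a single agent, with the Euclidean norm. -/
abbrev AgentSpace (M : ℕ) := EuclideanSpace ℝ (Fin M)

/-- The network space `ℝ^{NM}`: stacked vectors `col{w_1, …, w_N}` with the Euclidean norm
`‖w‖² = ∑ k, ‖w_k‖²`. -/
abbrev NetSpace (N M : ℕ) := PiLp 2 (fun _ : Fin N => AgentSpace M)

variable {N M G : ℕ}

/-- The Hessian `∇²f(w)`, as the derivative of the gradient field. -/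
def hessian (f : AgentSpace M → ℝ) (w : AgentSpace M) : AgentSpace M →L[ℝ] AgentSpace M :=
  fderiv ℝ (gradient f) w

/-- The continuous linear map `v ↦ col{T_1 v, …, T_N v}` into the network space. -/
def stackOp (T : Fin N → NetSpace N M →L[ℝ] AgentSpace M) : NetSpace N M →L[ℝ] NetSpace N M :=
  ((PiLp.continuousLinearEquiv 2 ℝ (fun _ : Fin N => AgentSpace M)).symm :
    (Fin N → AgentSpace M) →L[ℝ] NetSpace N M) ∘L ContinuousLinearMap.pi T

/-- The block diagonal operator `diag{T_1, …, T_N}` on the network space. -/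
def blockDiag (T : Fin N → AgentSpace M →L[ℝ] AgentSpace M) : NetSpace N M →L[ℝ] NetSpace N M :=
  stackOp fun k => T k ∘L PiLp.proj 2 (fun _ : Fin N => AgentSpace M) k

/-- The operator `(A ⊗ I_M)ᵀ` on the network space: `v ↦ col{∑ ℓ, a_{ℓk} v_ℓ}`. -/
def combineOp (A : Matrix (Fin N) (Fin N) ℝ) : NetSpace N M →L[ℝ] NetSpace N M :=
  stackOp fun k => ∑ l, A l k • PiLp.proj 2 (fun _ : Fin N => AgentSpace M) l

theorem stackOp_apply (T : Fin N → NetSpace N M →L[ℝ] AgentSpace M) (v : NetSpace N M)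
    (k : Fin N) : stackOp T v k = T k v := rfl

theorem blockDiag_apply (T : Fin N → AgentSpace M →L[ℝ] AgentSpace M) (v : NetSpace N M)
    (k : Fin N) : blockDiag T v k = T k (v k) := rfl

theorem combineOp_apply (A : Matrix (Fin N) (Fin N) ℝ) (v : NetSpace N M) (k : Fin N) :
    combineOp A v k = ∑ l, A l k • v l := by
  simp [combineOp, stackOp_apply]

/-- The operator `diag{μ_1, …, μ_N} ⊗ I_M` on the network space. -/
def stepOp (μ : Fin N → ℝ) : NetSpace N M →L[ℝ] NetSpace N M :=
  blockDiag fun k => μ k • ContinuousLinearMap.id ℝ (AgentSpace M)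

/-- The network Hessian `diag{∇²J_1(w_1), …, ∇²J_N(w_N)}`. -/
def netHessian (J : Fin N → AgentSpace M → ℝ) (w : NetSpace N M) :
    NetSpace N M →L[ℝ] NetSpace N M :=
  blockDiag fun k => hessian (J k) (w k)

/-- The largest step-size `μ_max = max_k μ_k`. -/
def stepMax (μ : Fin N → ℝ) : ℝ := ⨆ k, μ k

/-- Groups of agents in a network. The map `group` assigns to each agent its group, and
`wo` collects the minimizers of the individual costs. Two agents belong to the same cluster
exactly when their individual minimizers coincide. Every group is a nonempty connected set of
agents, and all its members belong to the same cluster. -/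
structure IsGrouping (graph : SimpleGraph (Fin N)) (group : Fin N → Fin G)
    (wo : NetSpace N M) : Prop where
  connected : ∀ m, (graph.induce {k | group k = m}).Connected
  same_cluster : ∀ k l, group k = group l → wo k = wo l

/-- Combination weights `a_{ℓk}` over the groups: positive if `ℓ` is a neighbour of `k` (every
agent being a neighbour of itself) in the same group as `k`, zero otherwise, and
`∑ ℓ, a_{ℓk} = 1`. -/
structure IsCombination (graph : SimpleGraph (Fin N)) (group : Fin N → Fin G)
    (A : Matrix (Fin N) (Fin N) ℝ) : Prop where
  pos : ∀ l k, (l = k ∨ graph.Adj l k) ∧ group l = group k → 0 < A l k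
  zero : ∀ l k, ¬ ((l = k ∨ graph.Adj l k) ∧ group l = group k) → A l k = 0
  sum_eq_one : ∀ k, ∑ l, A l k = 1

/-- The conditions on the individual costs `J_k`: each is strictly convex and twice
differentiable, with minimizer `wo k` and with `lamL k • I ≤ ∇²J_k ≤ lamU k • I`; in each group
some `lamL k` is positive; the network Hessian is `κH`-Lipschitz in operator norm. -/
structure IsCostFamily (group : Fin N → Fin G) (J : Fin N → AgentSpace M → ℝ)
    (wo : NetSpace N M) (lamL lamU : Fin N → ℝ) (κH : ℝ) : Prop where
  strictConvex : ∀ k, StrictConvexOn ℝ Set.univ (J k)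
  differentiable : ∀ k, Differentiable ℝ (J k)
  differentiable_gradient : ∀ k, Differentiable ℝ (gradient (J k))
  minimizer : ∀ k, IsMinOn (J k) Set.univ (wo k)
  lamL_nonneg : ∀ k, 0 ≤ lamL k
  lamL_le_lamU : ∀ k, lamL k ≤ lamU k
  hessian_lower : ∀ k w v, lamL k * ‖v‖ ^ 2 ≤ inner ℝ (hessian (J k) w v) v
  hessian_upper : ∀ k w v, inner ℝ (hessian (J k) w v) v ≤ lamU k * ‖v‖ ^ 2
  exists_strong : ∀ m, ∃ k, group k = m ∧ 0 < lamL k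
  κH_nonneg : 0 ≤ κH
  lipschitz : ∀ w₁ w₂ : NetSpace N M,
    ‖netHessian J w₁ - netHessian J w₂‖ ≤ κH * ‖w₁ - w₂‖

section Stochastic

variable {Ω : Type*}

/-- The network gradient noise `S(w) = col{ĝ_k(w_k) - ∇J_k(w_k)}`, where `ĝ_k` is a random
approximation of `∇J_k`. -/
def netNoise (J : Fin N → AgentSpace M → ℝ) (ghat : Fin N → AgentSpace M → Ω → AgentSpace M)
    (w : NetSpace N M) (ω : Ω) : NetSpace N M :=
  WithLp.toLp 2 fun k => ghat k (w k) ω - gradient (J k) (w k)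

/-- The conditions on the gradient noise. Here `ghat (n + 1) k` is the approximate gradient that
agent `k` uses at iteration `n + 1`, and `F n` is the information available after iteration `n`.
For every `F n`-measurable network vector `W`, the noise `S_{n+1}(W)` is `F (n+1)`-measurable; if
`W` has a finite fourth moment then so has `S_{n+1}(W)`, its conditional mean given `F n` is zero
and `E[‖S_{n+1}(W)‖⁴ | F n] ≤ α² ‖wo - W‖⁴ + σ⁴`. -/
structure IsGradientNoise [mΩ : MeasurableSpace Ω] (P : Measure Ω) (F : Filtration ℕ mΩ)
    (J : Fin N → AgentSpace M → ℝ) (wo : NetSpace N M)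
    (ghat : ℕ → Fin N → AgentSpace M → Ω → AgentSpace M) (α σ : ℝ) : Prop where
  adapted : ∀ (n : ℕ) (W : Ω → NetSpace N M), StronglyMeasurable[F n] W →
    StronglyMeasurable[F (n + 1)] fun ω => netNoise J (ghat (n + 1)) (W ω) ω
  memLp : ∀ (n : ℕ) (W : Ω → NetSpace N M), StronglyMeasurable[F n] W → MemLp W 4 P →
    MemLp (fun ω => netNoise J (ghat (n + 1)) (W ω) ω) 4 P
  condExp_eq_zero : ∀ (n : ℕ) (W : Ω → NetSpace N M), StronglyMeasurable[F n] W → MemLp W 4 P →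
    P[fun ω => netNoise J (ghat (n + 1)) (W ω) ω | F n] =ᵐ[P] 0
  fourth_moment : ∀ (n : ℕ) (W : Ω → NetSpace N M), StronglyMeasurable[F n] W → MemLp W 4 P →
    ∀ᵐ ω ∂P, (P[fun ω' => ‖netNoise J (ghat (n + 1)) (W ω') ω'‖ ^ 4 | F n]) ω
      ≤ α ^ 2 * ‖wo - W ω‖ ^ 4 + σ ^ 4

/-- The adapt-then-combine diffusion iterates started at `W₀`:
`ψ_ℓ = w_ℓ - μ_ℓ ĝ_ℓ(w_ℓ)` followed by `w_k = ∑ ℓ, a_{ℓk} ψ_ℓ`. -/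
def iterate (A : Matrix (Fin N) (Fin N) ℝ) (μ : Fin N → ℝ)
    (ghat : ℕ → Fin N → AgentSpace M → Ω → AgentSpace M) (W₀ : Ω → NetSpace N M) :
    ℕ → Ω → NetSpace N M
  | 0 => W₀
  | n + 1 => fun ω => WithLp.toLp 2 fun k =>
      ∑ l, A l k • (iterate A μ ghat W₀ n ω l
        - μ l • ghat (n + 1) l (iterate A μ ghat W₀ n ω l) ω)

/-- The network error vector `W̃_n = wo - W_n` of the diffusion iterates. -/
def netError (A : Matrix (Fin N) (Fin N) ℝ) (μ : Fin N → ℝ) (wo : NetSpace N M)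
    (ghat : ℕ → Fin N → AgentSpace M → Ω → AgentSpace M) (W₀ : Ω → NetSpace N M)
    (n : ℕ) (ω : Ω) : NetSpace N M :=
  wo - iterate A μ ghat W₀ n ω

/-- The constant coefficient `B = 𝒜ᵀ (I - ℳ ℋ)`, with `ℋ = diag{∇²J_k(wo k)}`. -/
def longOp (A : Matrix (Fin N) (Fin N) ℝ) (μ : Fin N → ℝ) (J : Fin N → AgentSpace M → ℝ)
    (wo : NetSpace N M) : NetSpace N M →L[ℝ] NetSpace N M :=
  combineOp A ∘L (ContinuousLinearMap.id ℝ (NetSpace N M) - stepOp μ ∘L netHessian J wo)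

/-- The long-term model started at `L₀`: `L_{n+1} = B L_n + 𝒜ᵀ ℳ S_{n+1}(W_n)`, driven by the
gradient noise evaluated at the diffusion iterates `W_n`. -/
def longError (A : Matrix (Fin N) (Fin N) ℝ) (μ : Fin N → ℝ) (J : Fin N → AgentSpace M → ℝ)
    (wo : NetSpace N M) (ghat : ℕ → Fin N → AgentSpace M → Ω → AgentSpace M)
    (W₀ L₀ : Ω → NetSpace N M) : ℕ → Ω → NetSpace N M
  | 0 => L₀
  | n + 1 => fun ω => longOp A μ J wo (longError A μ J wo ghat W₀ L₀ n ω)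
      + combineOp A (stepOp μ (netNoise J (ghat (n + 1)) (iterate A μ ghat W₀ n ω) ω))

end Stochastic

end

end MultitaskDiffusion

/-! All agents of a group share a minimizer, so the combination step fixes `wo`, and the error is a
noiseless gradient-and-combine step plus noise of size `t = stepMax μ`. Individual agents need not
contract, since `lamL k` may vanish. The remedy is the norm `‖R x‖² = ∑ p_k ‖x_k‖²`, with `p` a
positive fixed vector of `A`: combining loses exactly the dispersion of the values it averages,
while the gradient step loses energy at the strongly convex agents. On a connected group both losses
vanish only at zero, so by compactness the full step has factor `1 - c t` in squared norm, with `c`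
independent of the step-sizes (`exists_contraction`).

The noise is a martingale increment, so the term linear in it drops out of the fourth moment `e` of
the error. Young's inequality with parameter of order `t` leaves noise of order `t⁴ / t = t³`
against a contraction of order `t`, hence `e = O(t²)` in the limit
(`integral_netError_pow_four_succ_le`).

The true error and the long-term model are driven by the same noise, which cancels in their
difference. That difference obeys the contractive linear model, forced by the Taylor remainder of
the gradient, of size `t ‖x‖²`. Young turns its square into a forcing `O(t) e` of the mean-square
difference `d` (`integral_netError_sub_longError_sq_succ_le`), so `d` also settles at `O(t²)`
(`exists_le_of_coupled_recursion`). -/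

namespace MultitaskDiffusion

noncomputable section

variable {N M G : ℕ}

/-! ### Positive fixed vector of the combination matrix -/

/-- A column-stochastic matrix which is positive along the edges of a connected graph has a
positive fixed vector. -/
theorem exists_pos_mulVec_eq_self {ι : Type*} [Fintype ι] [Nonempty ι]
    (B : Matrix ι ι ℝ) (hB : ∀ l k, 0 ≤ B l k) (hsum : ∀ k, ∑ l, B l k = 1)
    (g : SimpleGraph ι) (hg : g.Connected) (hpos : ∀ l k, g.Adj l k → 0 < B l k) :
    ∃ p : ι → ℝ, (∀ k, 0 < p k) ∧ ∀ l, ∑ k, B l k * p k = p l := by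
  classical
  -- Unit column sums put the all-ones row vector in the left kernel of `B - 1`.
  have hdet : (B - 1).det = 0 := by
    refine Matrix.exists_vecMul_eq_zero_iff.1 ⟨fun _ => 1, ?_, ?_⟩
    · intro h
      exact one_ne_zero (congrFun h (Classical.arbitrary ι))
    · ext k
      simp [Matrix.vecMul, dotProduct, Matrix.one_apply, hsum]
  obtain ⟨q, hq0, hq⟩ := Matrix.exists_mulVec_eq_zero_iff.2 hdet
  have hfix : ∀ l, ∑ k, B l k * q k = q l := by
    intro l
    have := congrFun hq l
    rw [Matrix.sub_mulVec, Matrix.one_mulVec] at this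
    simpa [Matrix.mulVec, dotProduct, sub_eq_zero] using this
  have hle : ∀ l ∈ Finset.univ, |q l| ≤ ∑ k, B l k * |q k| := by
    intro l _
    calc |q l| = |∑ k, B l k * q k| := by rw [hfix]
      _ ≤ ∑ k, |B l k * q k| := Finset.abs_sum_le_sum_abs _ _
      _ = ∑ k, B l k * |q k| := by simp [abs_mul, abs_of_nonneg (hB _ _)]
  have hsums : ∑ l, |q l| = ∑ l, ∑ k, B l k * |q k| := by
    rw [Finset.sum_comm]
    simp [← Finset.sum_mul, hsum]
  -- The triangle inequalities `hle` have equal totals by column stochasticity, so each is an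
  -- equality and `|q|` is again fixed.
  have habs := (Finset.sum_eq_sum_iff_of_le hle).1 hsums
  refine ⟨fun k => |q k|, ?_, fun l => (habs l (Finset.mem_univ l)).symm⟩
  intro k
  refine abs_pos.2 fun hk => hq0 ?_
  funext l
  obtain ⟨w⟩ := hg.preconnected k l
  clear hq0
  -- A zero of `|q|` at `a` annihilates every term of the fixed-point sum at `a`, hence spreads to
  -- the neighbours of `a`, and by connectedness to all of `q`.
  induction w with
  | nil => exact hk
  | @cons a b c hab w ih =>
    refine ih ?_
    have h := habs a (Finset.mem_univ a)
    rw [hk, abs_zero, eq_comm, Finset.sum_eq_zero_iff_of_nonneg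
      fun i _ => mul_nonneg (hB a i) (abs_nonneg _)] at h
    have := h b (Finset.mem_univ b)
    simpa [(hpos a b hab).ne'] using this

theorem IsCombination.nonneg {graph : SimpleGraph (Fin N)} {group : Fin N → Fin G}
    {A : Matrix (Fin N) (Fin N) ℝ} (hA : IsCombination graph group A) (l k : Fin N) :
    0 ≤ A l k := by
  by_cases h : (l = k ∨ graph.Adj l k) ∧ group l = group k
  · exact (hA.pos l k h).le
  · exact (hA.zero l k h).ge

theorem IsCombination.eq_zero_of_group_ne {graph : SimpleGraph (Fin N)} {group : Fin N → Fin G}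
    {A : Matrix (Fin N) (Fin N) ℝ} (hA : IsCombination graph group A) {l k : Fin N}
    (h : group l ≠ group k) : A l k = 0 :=
  hA.zero l k fun h' => h h'.2

theorem sum_group_eq (group : Fin N → Fin G) (m : Fin G) (h : Fin N → ℝ)
    (h0 : ∀ k, group k ≠ m → h k = 0) :
    ∑ k : {k | group k = m}, h k.1 = ∑ k, h k := by
  classical
  rw [← Finset.sum_filter_of_ne (p := fun k => group k = m) (s := Finset.univ)
    (fun k _ hk => not_not.1 fun hne => hk (h0 k hne))]
  exact (Finset.sum_subtype _ (by simp) h).symm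

/-- The combination matrix has a positive right fixed vector. -/
theorem IsCombination.exists_perron {graph : SimpleGraph (Fin N)} {group : Fin N → Fin G}
    {wo : NetSpace N M} {A : Matrix (Fin N) (Fin N) ℝ}
    (hA : IsCombination graph group A) (hgroup : IsGrouping graph group wo) :
    ∃ p : Fin N → ℝ, (∀ k, 0 < p k) ∧ ∀ l, ∑ k, A l k * p k = p l := by
  classical
  have key : ∀ m : Fin G, ∃ p : {k | group k = m} → ℝ, (∀ k, 0 < p k) ∧
      ∀ l, ∑ k, A l.1 k.1 * p k = p l := by
    intro m
    have := (hgroup.connected m).nonempty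
    refine exists_pos_mulVec_eq_self (fun l k => A l.1 k.1) (fun l k => hA.nonneg _ _) ?_
      (graph.induce {k | group k = m}) (hgroup.connected m) ?_
    · intro k
      rw [← hA.sum_eq_one k.1]
      exact sum_group_eq group m (fun l => A l k.1)
        fun l hl => hA.eq_zero_of_group_ne (fun h => hl (h.trans k.2))
    · intro l k h
      exact hA.pos _ _ ⟨Or.inr h, l.2.trans k.2.symm⟩
  choose p hp hfix using key
  have hval : ∀ m (k : {k | group k = m}), p m k = p (group k.1) ⟨k.1, rfl⟩ := by
    rintro m ⟨k, rfl⟩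
    rfl
  refine ⟨fun k => p (group k) ⟨k, rfl⟩, fun k => hp _ _, fun l => ?_⟩
  refine Eq.trans ?_ (hfix (group l) ⟨l, rfl⟩)
  rw [← sum_group_eq group (group l) (fun k => A l k * p (group k) ⟨k, rfl⟩)
    fun k hk => by rw [hA.eq_zero_of_group_ne hk.symm, zero_mul]]
  exact Finset.sum_congr rfl fun k _ => congrArg (A l k.1 * ·) (hval _ k).symm

/-! ### Contraction in the Perron-weighted norm -/

/-- The variance identity: it makes the gap in Jensen's inequality exact, so that averaging gains
the whole dispersion. -/
theorem sum_weight_norm_sq_sub {ι E : Type*} [Fintype ι] [NormedAddCommGroup E]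
    [InnerProductSpace ℝ E] (w : ι → ℝ) (hw : ∑ l, w l = 1) (y : ι → E) :
    ∑ l, w l * ‖y l - ∑ j, w j • y j‖ ^ 2 = ∑ l, w l * ‖y l‖ ^ 2 - ‖∑ j, w j • y j‖ ^ 2 := by
  set m := ∑ j, w j • y j with hm
  have h1 : ∑ l, w l * inner ℝ (y l) m = ‖m‖ ^ 2 := by
    rw [← real_inner_self_eq_norm_sq]
    nth_rewrite 2 [hm]
    simp [sum_inner, inner_smul_left]
  simp only [norm_sub_sq_real, mul_add, mul_sub, Finset.sum_add_distrib, Finset.sum_sub_distrib,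
    ← Finset.sum_mul, hw]
  have h2 : ∑ l, w l * (2 * inner ℝ (y l) m) = 2 * ‖m‖ ^ 2 := by
    rw [← h1, Finset.mul_sum]
    exact Finset.sum_congr rfl fun _ _ => by ring
  rw [h2]
  ring

/-- A continuous function, homogeneous of degree two and positive off the origin, dominates a
multiple of the squared norm. -/
theorem exists_pos_mul_norm_sq_le {E : Type*} [NormedAddCommGroup E] [NormedSpace ℝ E]
    [FiniteDimensional ℝ E] (Q : E → ℝ) (hQ : Continuous Q)
    (hsmul : ∀ (c : ℝ) y, Q (c • y) = c ^ 2 * Q y) (hpos : ∀ y, y ≠ 0 → 0 < Q y) :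
    ∃ δ : ℝ, 0 < δ ∧ ∀ y, δ * ‖y‖ ^ 2 ≤ Q y := by
  have hQ0 : Q 0 = 0 := by simpa using hsmul 0 0
  rcases subsingleton_or_nontrivial E with hE | hE
  · exact ⟨1, one_pos, fun y => by simp [Subsingleton.elim y 0, hQ0]⟩
  · obtain ⟨z, hz, hmin⟩ := (isCompact_sphere (0 : E) 1).exists_isMinOn
      (NormedSpace.sphere_nonempty.2 zero_le_one) hQ.continuousOn
    have hz1 : ‖z‖ = 1 := by simpa using hz
    refine ⟨Q z, hpos z (by rintro rfl; simp at hz1), fun y => ?_⟩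
    by_cases hy : y = 0
    · simp [hy, hQ0]
    have hy' : ‖y‖ ≠ 0 := norm_ne_zero_iff.2 hy
    have h1 : Q z ≤ Q (‖y‖⁻¹ • y) := hmin (by simp [norm_smul, hy'])
    rw [hsmul, inv_pow] at h1
    have : 0 < ‖y‖ ^ 2 := by positivity
    calc Q z * ‖y‖ ^ 2 ≤ ((‖y‖ ^ 2)⁻¹ * Q y) * ‖y‖ ^ 2 := by gcongr
      _ = Q y := by field_simp

theorem norm_sq_eq_sum (v : NetSpace N M) : ‖v‖ ^ 2 = ∑ k, ‖v k‖ ^ 2 :=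
  PiLp.norm_sq_eq_of_L2 _ v

theorem stepOp_apply (μ : Fin N → ℝ) (v : NetSpace N M) (k : Fin N) :
    stepOp μ v k = μ k • v k := rfl

theorem norm_stepOp_sqrt_sq {p : Fin N → ℝ} (hp : ∀ k, 0 < p k) (v : NetSpace N M) :
    ‖stepOp (fun k => √(p k)) v‖ ^ 2 = ∑ k, p k * ‖v k‖ ^ 2 := by
  rw [norm_sq_eq_sum]
  refine Finset.sum_congr rfl fun k _ => ?_
  rw [stepOp_apply, norm_smul, mul_pow, Real.norm_eq_abs, sq_abs, Real.sq_sqrt (hp k).le]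

theorem norm_stepOp_le {μ : Fin N → ℝ} {t : ℝ} (ht : 0 ≤ t) (h0 : ∀ k, 0 ≤ μ k)
    (h : ∀ k, μ k ≤ t) (v : NetSpace N M) : ‖stepOp μ v‖ ≤ t * ‖v‖ := by
  refine le_of_sq_le_sq ?_ (by positivity)
  rw [mul_pow, norm_sq_eq_sum, norm_sq_eq_sum, Finset.mul_sum]
  refine Finset.sum_le_sum fun k _ => ?_
  rw [stepOp_apply, norm_smul, mul_pow, Real.norm_eq_abs, sq_abs]
  have := h0 k
  gcongr
  exact h k

/-- The dispersion of the combination step plus the strongly convex directions control the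
norm. -/
theorem exists_dispersion_lower_bound {graph : SimpleGraph (Fin N)} {group : Fin N → Fin G}
    {wo : NetSpace N M} {A : Matrix (Fin N) (Fin N) ℝ}
    (hA : IsCombination graph group A) (hgroup : IsGrouping graph group wo)
    {lam p : Fin N → ℝ} (hlam : ∀ k, 0 ≤ lam k) (hstrong : ∀ m, ∃ k, group k = m ∧ 0 < lam k)
    (hp : ∀ k, 0 < p k) :
    ∃ δ : ℝ, 0 < δ ∧ ∀ y : NetSpace N M, δ * ‖y‖ ^ 2 ≤
      ∑ k, p k * ∑ l, A l k * ‖y l - combineOp A y k‖ ^ 2 + ∑ k, p k * lam k * ‖y k‖ ^ 2 := by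
  refine exists_pos_mul_norm_sq_le _ ?_ ?_ ?_
  · have := (combineOp (M := M) A).continuous
    fun_prop
  · intro c y
    simp only [map_smul, PiLp.smul_apply, ← smul_sub, norm_smul, mul_pow, Real.norm_eq_abs, sq_abs,
      mul_add, Finset.mul_sum]
    congr 1
    · refine Finset.sum_congr rfl fun k _ => Finset.sum_congr rfl fun l _ => by ring
    · refine Finset.sum_congr rfl fun k _ => by ring
  · intro y hy
    have hn1 : ∀ k ∈ Finset.univ, 0 ≤ p k * ∑ l, A l k * ‖y l - combineOp A y k‖ ^ 2 :=
      fun k _ => mul_nonneg (hp k).le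
        (Finset.sum_nonneg fun l _ => mul_nonneg (hA.nonneg l k) (by positivity))
    have hn2 : ∀ k ∈ Finset.univ, 0 ≤ p k * lam k * ‖y k‖ ^ 2 :=
      fun k _ => mul_nonneg (mul_nonneg (hp k).le (hlam k)) (by positivity)
    refine lt_of_le_of_ne (add_nonneg (Finset.sum_nonneg hn1) (Finset.sum_nonneg hn2)) ?_
    intro h0
    rw [eq_comm, add_eq_zero_iff_of_nonneg (Finset.sum_nonneg hn1) (Finset.sum_nonneg hn2),
      Finset.sum_eq_zero_iff_of_nonneg hn1, Finset.sum_eq_zero_iff_of_nonneg hn2] at h0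
    obtain ⟨h1, h2⟩ := h0
    have hmean : ∀ l k, 0 < A l k → y l = combineOp A y k := by
      intro l k hlk
      have h := h1 k (Finset.mem_univ k)
      rw [mul_eq_zero, or_iff_right (hp k).ne', Finset.sum_eq_zero_iff_of_nonneg
        fun l _ => mul_nonneg (hA.nonneg l k) (by positivity)] at h
      have := h l (Finset.mem_univ l)
      rw [mul_eq_zero, or_iff_right hlk.ne', sq_eq_zero_iff, norm_eq_zero, sub_eq_zero] at this
      exact this
    refine hy ?_
    ext1 l
    obtain ⟨s, hs, hlams⟩ := hstrong (group l)
    have hys : y s = 0 := by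
      simpa [(hp s).ne', hlams.ne'] using h2 s (Finset.mem_univ s)
    -- Zero dispersion equates `y a` with the mean at `b` for each neighbour `a` of `b`; the
    -- self-weight of `b` equates `y b` with the same mean.
    have hwalk : ∀ a b : {k | group k = group l},
        ((graph.induce {k | group k = group l}).Walk a b) → y a.1 = y b.1 := by
      intro a b w
      induction w with
      | nil => rfl
      | @cons a b c hab w ih =>
        rw [← ih]
        have hg : group a.1 = group b.1 := a.2.trans b.2.symm
        rw [hmean a.1 b.1 (hA.pos _ _ ⟨Or.inr hab, hg⟩),
          hmean b.1 b.1 (hA.pos _ _ ⟨Or.inl rfl, rfl⟩)]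
    obtain ⟨w⟩ := (hgroup.connected (group l)).preconnected ⟨l, rfl⟩ ⟨s, hs⟩
    have := hwalk _ _ w
    simp only at this
    rw [this, hys]
    rfl

/-- A gradient step followed by a combination step contracts the norm weighted by the Perron
vector, at a rate proportional to the step-size. -/
theorem exists_contraction {graph : SimpleGraph (Fin N)} {group : Fin N → Fin G}
    {wo : NetSpace N M} {A : Matrix (Fin N) (Fin N) ℝ}
    (hA : IsCombination graph group A) (hgroup : IsGrouping graph group wo)
    {lam p : Fin N → ℝ} (hlam : ∀ k, 0 ≤ lam k) (hstrong : ∀ m, ∃ k, group k = m ∧ 0 < lam k)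
    (hp : ∀ k, 0 < p k) (hfix : ∀ l, ∑ k, A l k * p k = p l)
    {τ : ℝ} (hτ : 0 < τ) :
    ∃ c : ℝ, 0 < c ∧ c ≤ 1 ∧ ∀ (μ : Fin N → ℝ) (t : ℝ), 0 ≤ t → t ≤ 1 → (∀ k, τ * t ≤ μ k) →
      (∀ k, μ k * lam k ≤ 1) → ∀ x y : NetSpace N M,
      (∀ k, ‖y k‖ ≤ (1 - μ k * lam k) * ‖x k‖) →
      ‖stepOp (fun k => √(p k)) (combineOp A y)‖ ^ 2 ≤
        (1 - c * t) * ‖stepOp (fun k => √(p k)) x‖ ^ 2 := by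
  obtain ⟨δ, hδ, hQ⟩ := exists_dispersion_lower_bound (M := M) hA hgroup hlam hstrong hp
  set b : ℝ := min 1 τ with hb
  have hb0 : 0 < b := lt_min one_pos hτ
  have hP : ∀ k, p k ≤ ∑ j, p j := fun k =>
    Finset.single_le_sum (fun j _ => (hp j).le) (Finset.mem_univ k)
  have hS : 0 ≤ ∑ j, p j := Finset.sum_nonneg fun j _ => (hp j).le
  set K : ℝ := ∑ j, p j + 1 with hK
  have hK0 : 0 < K := by positivity
  set a : ℝ := min 1 (b * δ / K) with ha
  have ha0 : 0 < a := lt_min one_pos (by positivity)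
  have ha1 : a ≤ 1 := min_le_left _ _
  refine ⟨a / 2, by positivity, by linarith, ?_⟩
  intro μ t ht ht1 hμ hμl x y hxy
  rw [norm_stepOp_sqrt_sq hp, norm_stepOp_sqrt_sq hp]
  set X := ∑ k, p k * ‖x k‖ ^ 2 with hX
  set Y := ∑ k, p k * ‖y k‖ ^ 2 with hY
  set Z := ∑ k, p k * ‖combineOp A y k‖ ^ 2 with hZ
  set V := ∑ k, p k * ∑ l, A l k * ‖y l - combineOp A y k‖ ^ 2 with hV
  set W := ∑ k, p k * lam k * ‖y k‖ ^ 2 with hW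
  have hV0 : 0 ≤ V := Finset.sum_nonneg fun k _ => mul_nonneg (hp k).le
    (Finset.sum_nonneg fun l _ => mul_nonneg (hA.nonneg l k) (by positivity))
  have hW0 : 0 ≤ W := Finset.sum_nonneg fun k _ =>
    mul_nonneg (mul_nonneg (hp k).le (hlam k)) (by positivity)
  have hZ0 : 0 ≤ Z := Finset.sum_nonneg fun k _ => mul_nonneg (hp k).le (by positivity)
  have hX0 : 0 ≤ X := Finset.sum_nonneg fun k _ => mul_nonneg (hp k).le (by positivity)
  -- Summing the variance identity with weights `p k` and using `A p = p` gives back exactly `Y`.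
  have hVYZ : V = Y - Z := by
    have : ∀ k, ∑ l, A l k * ‖y l - combineOp A y k‖ ^ 2
        = ∑ l, A l k * ‖y l‖ ^ 2 - ‖combineOp A y k‖ ^ 2 := by
      intro k
      rw [combineOp_apply]
      exact sum_weight_norm_sq_sub (fun l => A l k) (hA.sum_eq_one k) (fun l => y l)
    simp only [hV, this, mul_sub, Finset.sum_sub_distrib, ← hZ]
    congr 1
    simp only [Finset.mul_sum]
    rw [Finset.sum_comm]
    refine Finset.sum_congr rfl fun l _ => ?_
    rw [← hfix l, Finset.sum_mul]
    exact Finset.sum_congr rfl fun k _ => by ring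
  have hXY : Y + τ * t * W ≤ X := by
    rw [hY, hW, hX, Finset.mul_sum, ← Finset.sum_add_distrib]
    refine Finset.sum_le_sum fun k _ => ?_
    have h0 : 0 ≤ μ k * lam k := mul_nonneg ((by positivity : 0 ≤ τ * t).trans (hμ k)) (hlam k)
    have h1 : ‖y k‖ ^ 2 ≤ (1 - μ k * lam k) ^ 2 * ‖x k‖ ^ 2 := by
      rw [← mul_pow]; exact pow_le_pow_left₀ (norm_nonneg _) (hxy k) 2
    -- With `s = μ k * lam k` in `[0, 1]`, `(1 + s)(1 - s)² ≤ 1`, so contraction by `1 - s` leaves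
    -- room for the extra energy `s ‖y k‖²`.
    have h2 : (1 + μ k * lam k) * (1 - μ k * lam k) ^ 2 ≤ 1 := by
      nlinarith [hμl k, mul_nonneg h0 h0, mul_nonneg (mul_nonneg h0 h0) (sub_nonneg.2 (hμl k))]
    have h3 : (1 + μ k * lam k) * ‖y k‖ ^ 2 ≤ ‖x k‖ ^ 2 := by
      calc (1 + μ k * lam k) * ‖y k‖ ^ 2
          ≤ (1 + μ k * lam k) * ((1 - μ k * lam k) ^ 2 * ‖x k‖ ^ 2) := by gcongr
        _ = ((1 + μ k * lam k) * (1 - μ k * lam k) ^ 2) * ‖x k‖ ^ 2 := by ring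
        _ ≤ 1 * ‖x k‖ ^ 2 := by gcongr
        _ = _ := one_mul _
    have h4 : τ * t * lam k ≤ μ k * lam k := mul_le_mul_of_nonneg_right (hμ k) (hlam k)
    have h5 : (1 + τ * t * lam k) * ‖y k‖ ^ 2 ≤ ‖x k‖ ^ 2 :=
      le_trans (by gcongr) h3
    calc p k * ‖y k‖ ^ 2 + τ * t * (p k * lam k * ‖y k‖ ^ 2)
        = p k * ((1 + τ * t * lam k) * ‖y k‖ ^ 2) := by ring
      _ ≤ _ := mul_le_mul_of_nonneg_left h5 (hp k).le
  have hYn : Y ≤ K * ‖y‖ ^ 2 := by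
    rw [norm_sq_eq_sum, hY, Finset.mul_sum]
    refine Finset.sum_le_sum fun k _ => ?_
    gcongr
    linarith [hP k]
  have hVW : δ / K * Y ≤ V + W := by
    calc δ / K * Y ≤ δ / K * (K * ‖y‖ ^ 2) := by gcongr
      _ = δ * ‖y‖ ^ 2 := by field_simp
      _ ≤ V + W := hQ y
  -- The losses give `Z + b t (V + W) ≤ X`. The factor `b` is at most `1` so that `b t V ≤ V`, and
  -- at most `τ` so that `b t W ≤ τ t W`; `a ≤ b δ / K` then makes `a t Z` fit under them.
  have hmain : (1 + a * t) * Z ≤ X := by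
    have h1 : b * t * V ≤ V := by
      have : b * t ≤ 1 := mul_le_one₀ (min_le_left _ _) ht ht1
      nlinarith
    have h2 : b * t * W ≤ τ * t * W := by
      have : b ≤ τ := min_le_right _ _
      gcongr
    have h3 : a * t * Z ≤ b * t * (V + W) := by
      calc a * t * Z ≤ (b * δ / K) * t * Y := by
            gcongr
            · exact min_le_right _ _
            · linarith
        _ = b * t * (δ / K * Y) := by ring
        _ ≤ _ := by gcongr
    linarith
  have hat : a * t ≤ 1 := mul_le_one₀ ha1 ht ht1
  have hat0 : 0 ≤ a * t := by positivity
  have h1 : 1 ≤ (1 - a / 2 * t) * (1 + a * t) := by nlinarith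
  have h2 : 0 ≤ 1 - a / 2 * t := by linarith
  calc Z ≤ ((1 - a / 2 * t) * (1 + a * t)) * Z := le_mul_of_one_le_left hZ0 h1
    _ = (1 - a / 2 * t) * ((1 + a * t) * Z) := by ring
    _ ≤ _ := by gcongr

/-! ### Gradient steps and Taylor remainder of a single agent -/

theorem hessian_inner_symm {f : AgentSpace M → ℝ} (hf : Differentiable ℝ f)
    (hg : Differentiable ℝ (gradient f)) (w u v : AgentSpace M) :
    inner ℝ (hessian f w u) v = inner ℝ (hessian f w v) u := by
  let L : AgentSpace M →L[ℝ] AgentSpace M →L[ℝ] ℝ := innerSL ℝ (E := AgentSpace M)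
  have h1 : ∀ y, HasFDerivAt f (L (gradient f y)) y :=
    fun y => (hf y).hasGradientAt.hasFDerivAt
  have h2 : HasFDerivAt (fun y => L (gradient f y)) (L ∘L hessian f w) w :=
    L.hasFDerivAt.comp w (hg w).hasFDerivAt
  exact second_derivative_symmetric h1 h2 u v

/-- The operator norm of a symmetric operator is bounded by any bound of its quadratic form. -/
theorem norm_le_of_inner_self_le {E : Type*} [NormedAddCommGroup E] [InnerProductSpace ℝ E]
    {T : E →L[ℝ] E} (hT : ∀ u v, inner ℝ (T u) v = inner ℝ (T v) u) {c : ℝ} (hc : 0 ≤ c)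
    (h : ∀ v, |inner ℝ (T v) v| ≤ c * ‖v‖ ^ 2) : ‖T‖ ≤ c := by
  have hs : T.IsSymmetric := fun u v => by
    change inner ℝ (T u) v = inner ℝ u (T v)
    rw [hT u v, real_inner_comm]
  rw [T.norm_eq_iSup_rayleighQuotient hs]
  refine ciSup_le fun v => ?_
  rw [ContinuousLinearMap.rayleighQuotient, ContinuousLinearMap.reApplyInnerSelf_apply, abs_div,
    abs_sq]
  refine div_le_of_le_mul₀ (by positivity) hc ?_
  simpa using h v

/-- The quadratic form of the symmetric operator lies between `1 - s b` and `1 - s a` times `‖v‖²`,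
and `s b ≤ 1` keeps the lower end nonnegative. -/
theorem norm_id_sub_smul_hessian_le {f : AgentSpace M → ℝ} (hf : Differentiable ℝ f)
    (hg : Differentiable ℝ (gradient f)) {a b s : ℝ} {w : AgentSpace M}
    (hlow : ∀ v, a * ‖v‖ ^ 2 ≤ inner ℝ (hessian f w v) v)
    (hupp : ∀ v, inner ℝ (hessian f w v) v ≤ b * ‖v‖ ^ 2) (hs : 0 ≤ s) (hab : a ≤ b)
    (hsb : s * b ≤ 1) :
    ‖ContinuousLinearMap.id ℝ (AgentSpace M) - s • hessian f w‖ ≤ 1 - s * a := by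
  have hsa : s * a ≤ s * b := mul_le_mul_of_nonneg_left hab hs
  refine norm_le_of_inner_self_le ?_ (by linarith) ?_
  · intro u v
    simp only [_root_.sub_apply, ContinuousLinearMap.id_apply,
      _root_.smul_apply, inner_sub_left, real_inner_smul_left]
    rw [hessian_inner_symm hf hg w u v, real_inner_comm]
  · intro v
    simp only [_root_.sub_apply, ContinuousLinearMap.id_apply,
      _root_.smul_apply, inner_sub_left, real_inner_smul_left,
      real_inner_self_eq_norm_sq]
    have h1 := mul_le_mul_of_nonneg_left (hlow v) hs
    have h2 := mul_le_mul_of_nonneg_left (hupp v) hs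
    have h3 : 0 ≤ (1 - s * b) * ‖v‖ ^ 2 := mul_nonneg (by linarith) (by positivity)
    rw [abs_le]
    constructor <;> nlinarith [sq_nonneg ‖v‖]

theorem gradient_eq_zero_of_isMinOn {f : AgentSpace M → ℝ} {w : AgentSpace M}
    (h : IsMinOn f Set.univ w) : gradient f w = 0 := by
  have : fderiv ℝ f w = 0 := (h.isLocalMin univ_mem).fderiv_eq_zero
  rw [gradient, this, map_zero]

/-- The gradient step is Lipschitz with constant `1 - s a`. -/
theorem norm_gradient_step_le {f : AgentSpace M → ℝ} (hf : Differentiable ℝ f)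
    (hg : Differentiable ℝ (gradient f)) {a b s : ℝ}
    (hlow : ∀ w v, a * ‖v‖ ^ 2 ≤ inner ℝ (hessian f w v) v)
    (hupp : ∀ w v, inner ℝ (hessian f w v) v ≤ b * ‖v‖ ^ 2) (hs : 0 ≤ s) (hab : a ≤ b)
    (hsb : s * b ≤ 1) {z : AgentSpace M} (hz : IsMinOn f Set.univ z) (x : AgentSpace M) :
    ‖x + s • gradient f (z - x)‖ ≤ (1 - s * a) * ‖x‖ := by
  have hd : ∀ w, HasFDerivAt (fun w => w - s • gradient f w)
      (ContinuousLinearMap.id ℝ (AgentSpace M) - s • hessian f w) w :=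
    fun w => (hasFDerivAt_id w).sub ((hg w).hasFDerivAt.const_smul s)
  -- The gradient step fixes the minimizer `z`, so the mean value inequality between `z - x` and `z`
  -- gives the bound.
  have := convex_univ.norm_image_sub_le_of_norm_hasFDerivWithin_le (𝕜 := ℝ) (x := z - x) (y := z)
    (fun w _ => (hd w).hasFDerivWithinAt)
    (fun w _ => norm_id_sub_smul_hessian_le hf hg (hlow w) (hupp w) hs hab hsb)
    (Set.mem_univ _) (Set.mem_univ _)
  rw [gradient_eq_zero_of_isMinOn hz] at this
  have h1 : z - s • (0 : AgentSpace M) - (z - x - s • gradient f (z - x))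
      = x + s • gradient f (z - x) := by
    rw [smul_zero]; abel
  rwa [h1, sub_sub_cancel] at this

theorem exists_apply_eq_and_norm_eq (k : Fin N) (v : AgentSpace M) :
    ∃ z : NetSpace N M, z k = v ∧ ‖z‖ = ‖v‖ :=
  ⟨PiLp.single 2 k v, PiLp.single_eq_same (β := fun _ : Fin N => AgentSpace M) 2 k v,
    PiLp.norm_single 2 (fun _ : Fin N => AgentSpace M) k v⟩

theorem norm_hessian_sub_le (J : Fin N → AgentSpace M → ℝ) (k : Fin N) (w₁ w₂ : NetSpace N M) :
    ‖hessian (J k) (w₁ k) - hessian (J k) (w₂ k)‖ ≤ ‖netHessian J w₁ - netHessian J w₂‖ := by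
  refine ContinuousLinearMap.opNorm_le_bound _ (norm_nonneg _) fun v => ?_
  obtain ⟨z, hzk, hz⟩ := exists_apply_eq_and_norm_eq k v
  have h := (netHessian J w₁ - netHessian J w₂).le_opNorm z
  rw [hz] at h
  refine le_trans ?_ h
  refine le_trans (le_of_eq ?_) (PiLp.norm_apply_le _ k)
  rw [← hzk]
  rfl

/-- First-order expansion of the gradient at the minimizer. -/
theorem norm_gradient_add_hessian_le {group : Fin N → Fin G} {J : Fin N → AgentSpace M → ℝ}
    {wo : NetSpace N M} {lamL lamU : Fin N → ℝ} {κH : ℝ}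
    (hJ : IsCostFamily group J wo lamL lamU κH) (k : Fin N) (x : NetSpace N M) :
    ‖gradient (J k) (wo k - x k) + hessian (J k) (wo k) (x k)‖ ≤ κH * ‖x k‖ ^ 2 := by
  have hb : ∀ w ∈ Metric.closedBall (wo k) ‖x k‖,
      ‖fderiv ℝ (gradient (J k)) w - hessian (J k) (wo k)‖ ≤ κH * ‖x k‖ := by
    intro w hw
    -- Perturbing `wo` in block `k` alone turns the network Lipschitz bound into one for agent `k`.
    obtain ⟨z, hzk, hz⟩ := exists_apply_eq_and_norm_eq k (w - wo k)
    have h2 := (norm_hessian_sub_le J k (wo + z) wo).trans (hJ.lipschitz _ _)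
    rw [add_sub_cancel_left, hz] at h2
    have h3 : (wo + z) k = w := by rw [PiLp.add_apply, hzk, add_sub_cancel]
    rw [h3] at h2
    refine h2.trans ?_
    have := hJ.κH_nonneg
    gcongr
    rwa [← dist_eq_norm]
  have := (convex_closedBall (wo k) ‖x k‖).norm_image_sub_le_of_norm_fderiv_le' (𝕜 := ℝ)
    (fun w _ => hJ.differentiable_gradient k w) hb (x := wo k) (y := wo k - x k)
    (by simp) (by simp)
  rw [gradient_eq_zero_of_isMinOn (hJ.minimizer k)] at this
  simpa [sq, mul_assoc] using this

/-! ### Fourth moments with a martingale increment -/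

section Moments

variable {Ω E : Type*} {m mΩ : MeasurableSpace Ω} {P : Measure Ω} [NormedAddCommGroup E]

theorem _root_.MeasureTheory.MemLp.integrable_norm_pow_four {f : Ω → E} (hf : MemLp f 4 P) :
    Integrable (fun ω => ‖f ω‖ ^ 4) P := by
  have := hf.integrable_norm_pow (by norm_num)
  simpa using this

variable [InnerProductSpace ℝ E]

/-- The term linear in `v` is kept exact, because its expectation will vanish. Cauchy–Schwarz and
`2ab ≤ a² + b²` bound the other mixed terms by `8 ‖u‖² ‖v‖² + 2 ‖v‖⁴`, and Young splits the first
with parameter `η`. -/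
theorem pow_four_add_le (u v : E) {η : ℝ} (hη : 0 < η) :
    ‖u + v‖ ^ 4 ≤ (1 + η) * ‖u‖ ^ 4 + 4 * inner ℝ (‖u‖ ^ 2 • u) v + (3 + 16 / η) * ‖v‖ ^ 4 := by
  have h0 : ‖u + v‖ ^ 4 = (‖u‖ ^ 2 + 2 * inner ℝ u v + ‖v‖ ^ 2) ^ 2 := by
    rw [← norm_add_sq_real]; ring
  rw [h0, real_inner_smul_left]
  have hi := abs_le.1 (abs_real_inner_le_norm u v)
  set i := inner ℝ u v
  set a := ‖u‖ with ha
  set b := ‖v‖ with hb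
  have ha0 : 0 ≤ a := norm_nonneg _
  have hb0 : 0 ≤ b := norm_nonneg _
  have h1 : i ^ 2 ≤ (a * b) ^ 2 := sq_le_sq' hi.1 hi.2
  have h2 : i * b ^ 2 ≤ a * b * b ^ 2 := mul_le_mul_of_nonneg_right hi.2 (by positivity)
  have h3 : 8 * (a ^ 2 * b ^ 2) ≤ η * a ^ 4 + 16 / η * b ^ 4 := by
    have : 0 ≤ (η * a ^ 2 - 4 * b ^ 2) ^ 2 / η := by positivity
    have h4 : (η * a ^ 2 - 4 * b ^ 2) ^ 2 / η
        = η * a ^ 4 + 16 / η * b ^ 4 - 8 * (a ^ 2 * b ^ 2) := by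
      field_simp; ring
    linarith
  nlinarith [mul_nonneg (sq_nonneg (a - b)) (sq_nonneg b)]

theorem integrable_inner_norm_sq_smul {u v : Ω → E} (hu : MemLp u 4 P) (hv : MemLp v 4 P) :
    Integrable (fun ω => inner ℝ (‖u ω‖ ^ 2 • u ω) (v ω)) P := by
  refine (hu.integrable_norm_pow_four.add hv.integrable_norm_pow_four).mono' ?_ ?_
  · exact ((hu.1.norm.pow 2).smul hu.1).inner hv.1
  · refine ae_of_all _ fun ω => ?_
    refine (norm_inner_le_norm _ _).trans ?_
    rw [norm_smul, norm_pow, norm_norm, Pi.add_apply]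
    have ha0 : 0 ≤ ‖u ω‖ := norm_nonneg _
    have hb0 : 0 ≤ ‖v ω‖ := norm_nonneg _
    set a := ‖u ω‖
    set b := ‖v ω‖
    nlinarith [sq_nonneg (a ^ 2 - a * b), sq_nonneg (a ^ 2 - b ^ 2), sq_nonneg (a * b),
      sq_nonneg (b ^ 2), sq_nonneg (a ^ 2)]

/-- Fourth moment of a sum whose second term is a martingale increment. -/
theorem integral_pow_four_add_le [IsProbabilityMeasure P] [CompleteSpace E]
    (hm : m ≤ mΩ) {u v : Ω → E} (hum : StronglyMeasurable[m] u)
    (hu : MemLp u 4 P) (hv : MemLp v 4 P) (hcond : P[v | m] =ᵐ[P] 0) {η : ℝ} (hη : 0 < η) :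
    ∫ ω, ‖u ω + v ω‖ ^ 4 ∂P ≤
      (1 + η) * ∫ ω, ‖u ω‖ ^ 4 ∂P + (3 + 16 / η) * ∫ ω, ‖v ω‖ ^ 4 ∂P := by
  have hI := integrable_inner_norm_sq_smul hu hv
  have hzero : ∫ ω, inner ℝ (‖u ω‖ ^ 2 • u ω) (v ω) ∂P = 0 := by
    let L : E →L[ℝ] E →L[ℝ] ℝ := innerSL ℝ (E := E)
    have hs : StronglyMeasurable[m] fun ω => ‖u ω‖ ^ 2 • u ω := (hum.norm.pow 2).smul hum
    have h := condExp_bilin_of_stronglyMeasurable_left (m := m) L hs hI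
      (hv.integrable (by norm_num))
    rw [← integral_condExp hm]
    refine integral_eq_zero_of_ae ?_
    filter_upwards [h, hcond] with ω h1 h2
    refine h1.trans ?_
    rw [h2]
    simp
  have hiu := hu.integrable_norm_pow_four.const_mul (1 + η)
  have hiv := hv.integrable_norm_pow_four.const_mul (3 + 16 / η)
  have hii := hI.const_mul 4
  calc ∫ ω, ‖u ω + v ω‖ ^ 4 ∂P
      ≤ ∫ ω, ((1 + η) * ‖u ω‖ ^ 4 + 4 * inner ℝ (‖u ω‖ ^ 2 • u ω) (v ω)
        + (3 + 16 / η) * ‖v ω‖ ^ 4) ∂P :=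
        integral_mono (hu.add hv).integrable_norm_pow_four ((hiu.add hii).add hiv)
          fun ω => pow_four_add_le _ _ hη
    _ = _ := by
      refine (integral_add (hiu.add hii) hiv).trans ?_
      refine (congrArg (· + _) (integral_add hiu hii)).trans ?_
      simp only [integral_const_mul, hzero]
      ring

end Moments

/-! ### Network error recursions and one-step bounds -/

/-- The network gradient `col{∇J_1(w_1), …, ∇J_N(w_N)}`. -/
def netGradient (J : Fin N → AgentSpace M → ℝ) (w : NetSpace N M) : NetSpace N M :=
  WithLp.toLp 2 fun k => gradient (J k) (w k)

theorem continuous_netGradient {J : Fin N → AgentSpace M → ℝ}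
    (hg : ∀ k, Differentiable ℝ (gradient (J k))) :
    Continuous (netGradient J : NetSpace N M → NetSpace N M) := by
  refine (PiLp.continuous_toLp 2 _).comp (continuous_pi fun k => ?_)
  exact (hg k).continuous.comp (PiLp.continuous_apply 2 _ k)

/-- The error after a noiseless local gradient step, before combination. -/
def errorStep (μ : Fin N → ℝ) (J : Fin N → AgentSpace M → ℝ) (wo x : NetSpace N M) :
    NetSpace N M :=
  x + stepOp μ (netGradient J (wo - x))

theorem errorStep_apply (μ : Fin N → ℝ) (J : Fin N → AgentSpace M → ℝ) (wo x : NetSpace N M)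
    (k : Fin N) : errorStep μ J wo x k = x k + μ k • gradient (J k) (wo k - x k) := rfl

theorem combineOp_fixed {graph : SimpleGraph (Fin N)} {group : Fin N → Fin G}
    {wo : NetSpace N M} {A : Matrix (Fin N) (Fin N) ℝ}
    (hA : IsCombination graph group A) (hgroup : IsGrouping graph group wo) :
    combineOp A wo = wo := by
  ext1 k
  rw [combineOp_apply]
  have : ∀ l ∈ Finset.univ, A l k • wo l = A l k • wo k := by
    intro l _
    by_cases h : group l = group k
    · rw [hgroup.same_cluster l k h]
    · rw [hA.eq_zero_of_group_ne h, zero_smul, zero_smul]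
  rw [Finset.sum_congr rfl this, ← Finset.sum_smul, hA.sum_eq_one, one_smul]

section Recursion

variable {Ω : Type*}

theorem netError_succ {A : Matrix (Fin N) (Fin N) ℝ} {wo : NetSpace N M}
    (hwo : combineOp A wo = wo) (μ : Fin N → ℝ) (J : Fin N → AgentSpace M → ℝ)
    (ghat : ℕ → Fin N → AgentSpace M → Ω → AgentSpace M) (W₀ : Ω → NetSpace N M)
    (n : ℕ) (ω : Ω) :
    netError A μ wo ghat W₀ (n + 1) ω =
      combineOp A (errorStep μ J wo (netError A μ wo ghat W₀ n ω)) +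
        combineOp A (stepOp μ (netNoise J (ghat (n + 1)) (iterate A μ ghat W₀ n ω) ω)) := by
  have hit : iterate A μ ghat W₀ (n + 1) ω = combineOp A (iterate A μ ghat W₀ n ω -
      stepOp μ (WithLp.toLp 2 fun l => ghat (n + 1) l (iterate A μ ghat W₀ n ω l) ω)) := by
    ext1 k
    rw [combineOp_apply]
    rfl
  rw [netError, hit, ← map_add]
  nth_rewrite 1 [← hwo]
  rw [← map_sub]
  congr 1
  ext1 k
  simp only [PiLp.sub_apply, PiLp.add_apply, stepOp_apply, errorStep_apply, netError, netNoise,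
    sub_sub_cancel, smul_sub]
  abel

/-- Both recursions see the same noise sample, so only the first-order Taylor remainder of the
gradient is left as forcing. -/
theorem netError_sub_longError_succ {A : Matrix (Fin N) (Fin N) ℝ} {wo : NetSpace N M}
    (hwo : combineOp A wo = wo) (μ : Fin N → ℝ) (J : Fin N → AgentSpace M → ℝ)
    (ghat : ℕ → Fin N → AgentSpace M → Ω → AgentSpace M) (W₀ L₀ : Ω → NetSpace N M)
    (n : ℕ) (ω : Ω) :
    netError A μ wo ghat W₀ (n + 1) ω - longError A μ J wo ghat W₀ L₀ (n + 1) ω =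
      longOp A μ J wo (netError A μ wo ghat W₀ n ω - longError A μ J wo ghat W₀ L₀ n ω) +
        combineOp A (stepOp μ (netGradient J (wo - netError A μ wo ghat W₀ n ω) +
          netHessian J wo (netError A μ wo ghat W₀ n ω))) := by
  rw [netError_succ hwo μ J, longError, map_sub]
  simp only [longOp, errorStep, ContinuousLinearMap.comp_apply, _root_.sub_apply,
    ContinuousLinearMap.id_apply, map_add, map_sub]
  abel

end Recursion

theorem norm_le_of_forall_apply_le {x y : NetSpace N M} (h : ∀ k, ‖y k‖ ≤ ‖x k‖) : ‖y‖ ≤ ‖x‖ := by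
  refine le_of_sq_le_sq ?_ (norm_nonneg _)
  rw [norm_sq_eq_sum, norm_sq_eq_sum]
  exact Finset.sum_le_sum fun k _ => pow_le_pow_left₀ (norm_nonneg _) (h k) 2

section Costs

variable {group : Fin N → Fin G} {J : Fin N → AgentSpace M → ℝ} {wo : NetSpace N M}
  {lamL lamU : Fin N → ℝ} {κH : ℝ}

theorem IsCostFamily.norm_errorStep_apply_le (hJ : IsCostFamily group J wo lamL lamU κH)
    {μ : Fin N → ℝ} (hμ : ∀ k, 0 ≤ μ k) (hμU : ∀ k, μ k * lamU k ≤ 1) (x : NetSpace N M)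
    (k : Fin N) : ‖errorStep μ J wo x k‖ ≤ (1 - μ k * lamL k) * ‖x k‖ :=
  norm_gradient_step_le (hJ.differentiable k) (hJ.differentiable_gradient k)
    (hJ.hessian_lower k) (hJ.hessian_upper k) (hμ k) (hJ.lamL_le_lamU k) (hμU k)
    (hJ.minimizer k) (x k)

theorem IsCostFamily.norm_errorStep_le (hJ : IsCostFamily group J wo lamL lamU κH)
    {μ : Fin N → ℝ} (hμ : ∀ k, 0 ≤ μ k) (hμU : ∀ k, μ k * lamU k ≤ 1) (x : NetSpace N M) :
    ‖errorStep μ J wo x‖ ≤ ‖x‖ := by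
  refine norm_le_of_forall_apply_le fun k => (hJ.norm_errorStep_apply_le hμ hμU x k).trans ?_
  refine mul_le_of_le_one_left (norm_nonneg _) ?_
  linarith [mul_nonneg (hμ k) (hJ.lamL_nonneg k)]

theorem IsCostFamily.norm_linear_step_apply_le (hJ : IsCostFamily group J wo lamL lamU κH)
    {μ : Fin N → ℝ} (hμ : ∀ k, 0 ≤ μ k) (hμU : ∀ k, μ k * lamU k ≤ 1) (x : NetSpace N M)
    (k : Fin N) : ‖(x - stepOp μ (netHessian J wo x)) k‖ ≤ (1 - μ k * lamL k) * ‖x k‖ :=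
  (ContinuousLinearMap.le_opNorm (ContinuousLinearMap.id ℝ (AgentSpace M) -
      μ k • hessian (J k) (wo k)) (x k)).trans
    (mul_le_mul_of_nonneg_right (norm_id_sub_smul_hessian_le (hJ.differentiable k)
      (hJ.differentiable_gradient k) (hJ.hessian_lower k (wo k)) (hJ.hessian_upper k (wo k))
      (hμ k) (hJ.lamL_le_lamU k) (hμU k)) (norm_nonneg _))

theorem IsCostFamily.norm_netGradient_add_le (hJ : IsCostFamily group J wo lamL lamU κH)
    (x : NetSpace N M) :
    ‖netGradient J (wo - x) + netHessian J wo x‖ ≤ κH * ‖x‖ ^ 2 := by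
  have hκ := hJ.κH_nonneg
  refine le_of_sq_le_sq ?_ (by positivity)
  calc ‖netGradient J (wo - x) + netHessian J wo x‖ ^ 2
      = ∑ k, ‖gradient (J k) (wo k - x k) + hessian (J k) (wo k) (x k)‖ ^ 2 := norm_sq_eq_sum _
    _ ≤ ∑ k, κH ^ 2 * ‖x‖ ^ 2 * ‖x k‖ ^ 2 := by
        refine Finset.sum_le_sum fun k _ => ?_
        calc _ ≤ (κH * ‖x k‖ ^ 2) ^ 2 :=
              pow_le_pow_left₀ (norm_nonneg _) (norm_gradient_add_hessian_le hJ k x) 2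
          _ = κH ^ 2 * ‖x k‖ ^ 2 * ‖x k‖ ^ 2 := by ring
          -- One factor `‖x k‖²` is bounded by `‖x‖²`; the other is kept to sum back to `‖x‖²`.
          _ ≤ _ := by
            gcongr
            exact PiLp.norm_apply_le x k
    _ = (κH * ‖x‖ ^ 2) ^ 2 := by
        rw [← Finset.mul_sum, ← norm_sq_eq_sum]
        ring

end Costs

/-- One-step bounds for the error recursions in the norm `‖R ·‖`, with step-size `t`. -/
structure ErrorBounds (R : NetSpace N M →L[ℝ] NetSpace N M) (A : Matrix (Fin N) (Fin N) ℝ)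
    (μ : Fin N → ℝ) (J : Fin N → AgentSpace M → ℝ) (wo : NetSpace N M) (κ c K t : ℝ) : Prop where
  norm_errorStep : ∀ x, ‖errorStep μ J wo x‖ ≤ ‖x‖
  contract : ∀ x, ‖R (combineOp A (errorStep μ J wo x))‖ ^ 2 ≤ (1 - c * t) * ‖R x‖ ^ 2
  contract_long : ∀ x, ‖R (longOp A μ J wo x)‖ ^ 2 ≤ (1 - c * t) * ‖R x‖ ^ 2
  noise : ∀ v, ‖R (combineOp A (stepOp μ v))‖ ≤ K * t * ‖v‖
  lower : ∀ x, ‖x‖ ≤ K * ‖R x‖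
  taylor : ∀ x, ‖netGradient J (wo - x) + netHessian J wo x‖ ≤ κ * ‖x‖ ^ 2

/-- The constants are chosen before `μ`, which makes the final `C` uniform. The cap `t₀` enforces `μ
k * lamU k ≤ 1`, and `R'` inverts `R`, so the norms are equivalent. -/
theorem exists_errorBounds {graph : SimpleGraph (Fin N)} {group : Fin N → Fin G}
    {J : Fin N → AgentSpace M → ℝ} {wo : NetSpace N M} {A : Matrix (Fin N) (Fin N) ℝ}
    {lamL lamU : Fin N → ℝ} {κH τ : ℝ} (hgroup : IsGrouping graph group wo)
    (hA : IsCombination graph group A) (hJ : IsCostFamily group J wo lamL lamU κH) (hτ : 0 < τ) :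
    ∃ (R : NetSpace N M →L[ℝ] NetSpace N M) (c K t₀ : ℝ), 0 < c ∧ c ≤ 1 ∧ 0 < K ∧ 0 < t₀ ∧
      t₀ ≤ 1 ∧ ∀ (μ : Fin N → ℝ) (t : ℝ), (∀ k, 0 ≤ μ k) → (∀ k, μ k ≤ t) → 0 ≤ t → t ≤ t₀ →
        (∀ k, τ * t ≤ μ k) → ErrorBounds R A μ J wo κH c K t := by
  obtain ⟨p, hp, hfix⟩ := hA.exists_perron hgroup
  obtain ⟨c, hc, hc1, hcontr⟩ := exists_contraction (M := M) hA hgroup hJ.lamL_nonneg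
    hJ.exists_strong hp hfix hτ
  set R : NetSpace N M →L[ℝ] NetSpace N M := stepOp fun k => √(p k) with hR
  set R' : NetSpace N M →L[ℝ] NetSpace N M := stepOp fun k => (√(p k))⁻¹ with hR'
  have hRR : ∀ x, R' (R x) = x := by
    intro x
    ext1 k
    rw [hR, hR', stepOp_apply, stepOp_apply, inv_smul_smul₀ (Real.sqrt_pos.2 (hp k)).ne']
  have hU : ∀ k, 0 ≤ lamU k := fun k => (hJ.lamL_nonneg k).trans (hJ.lamL_le_lamU k)
  have hU0 : 0 ≤ ∑ k, lamU k := Finset.sum_nonneg fun k _ => hU k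
  refine ⟨R, c, ‖R ∘L combineOp A‖ + ‖R'‖ + 1, (∑ k, lamU k + 1)⁻¹, hc, hc1, by positivity,
    by positivity, inv_le_one_of_one_le₀ (by linarith), ?_⟩
  intro μ t hμ0 hμt ht ht0 hτμ
  have hμU : ∀ k, μ k * lamU k ≤ 1 := by
    intro k
    have h1 : lamU k ≤ ∑ j, lamU j + 1 := by
      linarith [Finset.single_le_sum (fun j _ => hU j) (Finset.mem_univ k)]
    calc μ k * lamU k ≤ (∑ k, lamU k + 1)⁻¹ * (∑ j, lamU j + 1) :=
          mul_le_mul ((hμt k).trans ht0) h1 (hU k) (by positivity)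
      _ = 1 := inv_mul_cancel₀ (by positivity)
  have hμL : ∀ k, μ k * lamL k ≤ 1 := fun k =>
    (mul_le_mul_of_nonneg_left (hJ.lamL_le_lamU k) (hμ0 k)).trans (hμU k)
  have ht1 : t ≤ 1 := ht0.trans (inv_le_one_of_one_le₀ (by linarith))
  refine ⟨hJ.norm_errorStep_le hμ0 hμU, ?_, ?_, ?_, ?_, hJ.norm_netGradient_add_le⟩
  · exact fun x => hcontr μ t ht ht1 hτμ hμL x _ (hJ.norm_errorStep_apply_le hμ0 hμU x)
  · exact fun x => hcontr μ t ht ht1 hτμ hμL x _ (hJ.norm_linear_step_apply_le hμ0 hμU x)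
  · intro v
    calc ‖R (combineOp A (stepOp μ v))‖ ≤ ‖R ∘L combineOp A‖ * ‖stepOp μ v‖ :=
          (R ∘L combineOp A).le_opNorm _
      _ ≤ (‖R ∘L combineOp A‖ + ‖R'‖ + 1) * (t * ‖v‖) := by
          gcongr
          · linarith [norm_nonneg R']
          · exact norm_stepOp_le ht hμ0 hμt v
      _ = _ := by ring
  · intro x
    calc ‖x‖ = ‖R' (R x)‖ := by rw [hRR]
      _ ≤ ‖R'‖ * ‖R x‖ := R'.le_opNorm _
      _ ≤ _ := by
        gcongr
        linarith [norm_nonneg (R ∘L combineOp A)]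

/-! ### Moment recursions -/

section Stochastic

variable {Ω : Type*} {mΩ : MeasurableSpace Ω} {P : Measure Ω} [IsProbabilityMeasure P]
  {F : Filtration ℕ mΩ} {J : Fin N → AgentSpace M → ℝ} {wo : NetSpace N M}
  {ghat : ℕ → Fin N → AgentSpace M → Ω → AgentSpace M} {α σ : ℝ}
  {A : Matrix (Fin N) (Fin N) ℝ} {μ : Fin N → ℝ} {W₀ L₀ : Ω → NetSpace N M}

theorem iterate_eq_sub (n : ℕ) :
    iterate A μ ghat W₀ n = fun ω => wo - netError A μ wo ghat W₀ n ω := by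
  funext ω
  simp [netError]

/-- Adaptedness and fourth moments must propagate together, since the noise hypotheses at each step
require both. The noiseless step is nonexpansive, so it preserves the moment. -/
theorem stronglyMeasurable_netError_and_memLp (hnoise : IsGradientNoise P F J wo ghat α σ)
    (hg : ∀ k, Differentiable ℝ (gradient (J k))) (hwo : combineOp A wo = wo)
    (hstep : ∀ x, ‖errorStep μ J wo x‖ ≤ ‖x‖) (hW : StronglyMeasurable[F 0] W₀)
    (hW4 : MemLp W₀ 4 P) (n : ℕ) :
    StronglyMeasurable[F n] (netError A μ wo ghat W₀ n) ∧
      MemLp (netError A μ wo ghat W₀ n) 4 P := by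
  induction n with
  | zero => exact ⟨stronglyMeasurable_const.sub hW, (memLp_const wo).sub hW4⟩
  | succ n ih =>
    obtain ⟨h1, h2⟩ := ih
    have hit : StronglyMeasurable[F n] (iterate A μ ghat W₀ n) := by
      rw [iterate_eq_sub (wo := wo)]
      exact stronglyMeasurable_const.sub h1
    have hit4 : MemLp (iterate A μ ghat W₀ n) 4 P := by
      rw [iterate_eq_sub (wo := wo)]
      exact (memLp_const wo).sub h2
    have hcont : Continuous (errorStep μ J wo) :=
      continuous_id.add ((stepOp μ).continuous.comp
        ((continuous_netGradient hg).comp (continuous_const.sub continuous_id)))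
    have hy := hcont.comp_stronglyMeasurable h1
    have hy4 : MemLp (fun ω => errorStep μ J wo (netError A μ wo ghat W₀ n ω)) 4 P :=
      h2.of_le (hy.mono (F.le n)).aestronglyMeasurable (ae_of_all _ fun ω => hstep _)
    have hs := hnoise.adapted n _ hit
    have hs4 := hnoise.memLp n _ hit hit4
    rw [show netError A μ wo ghat W₀ (n + 1) = _ from funext (netError_succ hwo μ J ghat W₀ n)]
    constructor
    · exact ((combineOp A).continuous.comp_stronglyMeasurable (hy.mono (F.mono n.le_succ))).add
        ((combineOp A ∘L stepOp μ).continuous.comp_stronglyMeasurable hs)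
    · exact ((combineOp A).comp_memLp' hy4).add ((combineOp A ∘L stepOp μ).comp_memLp' hs4)

theorem IsGradientNoise.integral_pow_four_le (hnoise : IsGradientNoise P F J wo ghat α σ) (n : ℕ)
    {W : Ω → NetSpace N M} (hW : StronglyMeasurable[F n] W) (hW4 : MemLp W 4 P) :
    ∫ ω, ‖netNoise J (ghat (n + 1)) (W ω) ω‖ ^ 4 ∂P ≤
      α ^ 2 * ∫ ω, ‖wo - W ω‖ ^ 4 ∂P + σ ^ 4 := by
  have hI : Integrable (fun ω => α ^ 2 * ‖wo - W ω‖ ^ 4) P :=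
    ((memLp_const wo).sub hW4).integrable_norm_pow_four.const_mul _
  rw [← integral_condExp (F.le n)]
  refine (integral_mono_ae integrable_condExp (hI.add (integrable_const (σ ^ 4)))
    (hnoise.fourth_moment n W hW hW4)).trans (le_of_eq ?_)
  refine (integral_add hI (integrable_const _)).trans ?_
  rw [integral_const_mul]
  simp

variable {R : NetSpace N M →L[ℝ] NetSpace N M} {κ c K t : ℝ}

/-- Recursion for the fourth moment of the network error. -/
theorem integral_netError_pow_four_succ_le (hnoise : IsGradientNoise P F J wo ghat α σ)
    (hg : ∀ k, Differentiable ℝ (gradient (J k))) (hwo : combineOp A wo = wo)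
    (hb : ErrorBounds R A μ J wo κ c K t) (hc : 0 < c) (hc1 : c ≤ 1) (hK : 0 < K) (ht : 0 < t)
    (ht1 : t ≤ 1) (hW : StronglyMeasurable[F 0] W₀) (hW4 : MemLp W₀ 4 P) (n : ℕ) :
    ∫ ω, ‖R (netError A μ wo ghat W₀ (n + 1) ω)‖ ^ 4 ∂P ≤
      (1 - c * t / 2) * ∫ ω, ‖R (netError A μ wo ghat W₀ n ω)‖ ^ 4 ∂P +
        35 * K ^ 4 / c * t ^ 3 *
          (α ^ 2 * K ^ 4 * ∫ ω, ‖R (netError A μ wo ghat W₀ n ω)‖ ^ 4 ∂P + σ ^ 4) := by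
  obtain ⟨h1, h2⟩ := stronglyMeasurable_netError_and_memLp (A := A) hnoise hg hwo
    hb.norm_errorStep hW hW4 n
  have hit : StronglyMeasurable[F n] (iterate A μ ghat W₀ n) := by
    rw [iterate_eq_sub (wo := wo)]
    exact stronglyMeasurable_const.sub h1
  have hit4 : MemLp (iterate A μ ghat W₀ n) 4 P := by
    rw [iterate_eq_sub (wo := wo)]
    exact (memLp_const wo).sub h2
  have hcont : Continuous (errorStep μ J wo) :=
    continuous_id.add ((stepOp μ).continuous.comp
      ((continuous_netGradient hg).comp (continuous_const.sub continuous_id)))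
  have hy := hcont.comp_stronglyMeasurable h1
  have hy4 : MemLp (fun ω => errorStep μ J wo (netError A μ wo ghat W₀ n ω)) 4 P :=
    h2.of_le (hy.mono (F.le n)).aestronglyMeasurable (ae_of_all _ fun ω => hb.norm_errorStep _)
  have hs4 := hnoise.memLp n _ hit hit4
  set S : Ω → NetSpace N M := fun ω => netNoise J (ghat (n + 1)) (iterate A μ ghat W₀ n ω) ω
    with hS
  set x := netError A μ wo ghat W₀ n with hx
  set Q : NetSpace N M →L[ℝ] NetSpace N M := R ∘L combineOp A with hQ
  set B : NetSpace N M →L[ℝ] NetSpace N M := R ∘L combineOp A ∘L stepOp μ with hB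
  have hcond : P[fun ω => B (S ω) | F n] =ᵐ[P] 0 := by
    refine (B.comp_condExp_comm (hs4.integrable (by norm_num))).symm.trans ?_
    filter_upwards [hnoise.condExp_eq_zero n _ hit hit4] with ω hω
    rw [Function.comp_apply, hω]
    simp
  -- With `η = c t / 2`, half of the contraction survives: `(1 + η)(1 - c t) ≤ 1 - c t / 2`.
  have hmain := integral_pow_four_add_le (F.le n) (Q.continuous.comp_stronglyMeasurable hy)
    (Q.comp_memLp' hy4) (B.comp_memLp' hs4) hcond (η := c * t / 2) (by positivity)
  have hxR : Integrable (fun ω => ‖R (x ω)‖ ^ 4) P :=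
    (R.comp_memLp' h2).integrable_norm_pow_four
  set e := ∫ ω, ‖R (x ω)‖ ^ 4 ∂P with he
  have he0 : 0 ≤ e := integral_nonneg fun ω => by positivity
  have hct : c * t ≤ 1 := mul_le_one₀ hc1 ht.le ht1
  have hct0 : 0 < c * t := by positivity
  have hA1 : ∫ ω, ‖Q (errorStep μ J wo (x ω))‖ ^ 4 ∂P ≤ (1 - c * t) * e := by
    rw [he, ← integral_const_mul]
    refine integral_mono (Q.comp_memLp' hy4).integrable_norm_pow_four (hxR.const_mul _) fun ω => ?_
    have h := hb.contract (x ω)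
    calc ‖Q (errorStep μ J wo (x ω))‖ ^ 4
        = (‖R (combineOp A (errorStep μ J wo (x ω)))‖ ^ 2) ^ 2 := by rw [hQ]; simp [← pow_mul]
      _ ≤ ((1 - c * t) * ‖R (x ω)‖ ^ 2) ^ 2 := pow_le_pow_left₀ (by positivity) h 2
      _ = (1 - c * t) * ((1 - c * t) * ‖R (x ω)‖ ^ 4) := by ring
      _ ≤ 1 * ((1 - c * t) * ‖R (x ω)‖ ^ 4) := by
        have : 0 ≤ 1 - c * t := by linarith
        gcongr
        linarith
      _ = _ := one_mul _
  have hA2 : ∫ ω, ‖B (S ω)‖ ^ 4 ∂P ≤ (K * t) ^ 4 * (α ^ 2 * K ^ 4 * e + σ ^ 4) := by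
    have hI1 : ∫ ω, ‖B (S ω)‖ ^ 4 ∂P ≤ (K * t) ^ 4 * ∫ ω, ‖S ω‖ ^ 4 ∂P := by
      rw [← integral_const_mul]
      refine integral_mono (B.comp_memLp' hs4).integrable_norm_pow_four
        (hs4.integrable_norm_pow_four.const_mul _) fun ω => ?_
      simp only [← mul_pow]
      exact pow_le_pow_left₀ (norm_nonneg _) (hb.noise _) 4
    have hI2 : ∫ ω, ‖wo - iterate A μ ghat W₀ n ω‖ ^ 4 ∂P ≤ K ^ 4 * e := by
      rw [he, ← integral_const_mul]
      refine integral_mono h2.integrable_norm_pow_four (hxR.const_mul _) fun ω => ?_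
      simp only [← mul_pow]
      exact pow_le_pow_left₀ (norm_nonneg _) (hb.lower _) 4
    refine hI1.trans ?_
    refine mul_le_mul_of_nonneg_left ?_ (by positivity)
    refine (hnoise.integral_pow_four_le n hit hit4).trans ?_
    rw [mul_assoc]
    gcongr
  have hlhs : ∫ ω, ‖R (netError A μ wo ghat W₀ (n + 1) ω)‖ ^ 4 ∂P
      = ∫ ω, ‖Q (errorStep μ J wo (x ω)) + B (S ω)‖ ^ 4 ∂P := by
    refine integral_congr_ae (ae_of_all _ fun ω => ?_)
    simp only [netError_succ hwo μ J, map_add]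
    rfl
  rw [hlhs]
  refine hmain.trans (add_le_add ?_ ?_)
  · calc (1 + c * t / 2) * ∫ ω, ‖Q (errorStep μ J wo (x ω))‖ ^ 4 ∂P
        ≤ (1 + c * t / 2) * ((1 - c * t) * e) := by gcongr
      _ = ((1 + c * t / 2) * (1 - c * t)) * e := by ring
      _ ≤ _ := by
        gcongr
        nlinarith
  · set Z := α ^ 2 * K ^ 4 * e + σ ^ 4 with hZ
    have hZ0 : 0 ≤ Z := by positivity
    calc (3 + 16 / (c * t / 2)) * ∫ ω, ‖B (S ω)‖ ^ 4 ∂P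
        ≤ (3 + 16 / (c * t / 2)) * ((K * t) ^ 4 * Z) := by gcongr
      _ = (3 * (c * t) + 32) * (K ^ 4 / c * t ^ 3 * Z) := by field_simp; ring
      -- `35 = 3 + 32`, from `c t ≤ 1`; the `32 / (c t)` in Young's constant costs one of the four
      -- powers of `t`.
      _ ≤ 35 * (K ^ 4 / c * t ^ 3 * Z) := by
        gcongr
        linarith
      _ = _ := by ring

theorem memLp_longError (hnoise : IsGradientNoise P F J wo ghat α σ)
    (hg : ∀ k, Differentiable ℝ (gradient (J k))) (hwo : combineOp A wo = wo)
    (hstep : ∀ x, ‖errorStep μ J wo x‖ ≤ ‖x‖) (hW : StronglyMeasurable[F 0] W₀)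
    (hW4 : MemLp W₀ 4 P) (hL : MemLp L₀ 2 P) (n : ℕ) :
    MemLp (longError A μ J wo ghat W₀ L₀ n) 2 P := by
  induction n with
  | zero => exact hL
  | succ n ih =>
    obtain ⟨h1, h2⟩ := stronglyMeasurable_netError_and_memLp (A := A) hnoise hg hwo hstep hW hW4 n
    have hit : StronglyMeasurable[F n] (iterate A μ ghat W₀ n) := by
      rw [iterate_eq_sub (wo := wo)]
      exact stronglyMeasurable_const.sub h1
    have hit4 : MemLp (iterate A μ ghat W₀ n) 4 P := by
      rw [iterate_eq_sub (wo := wo)]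
      exact (memLp_const wo).sub h2
    have hs2 := (hnoise.memLp n _ hit hit4).mono_exponent (p := 2) (by norm_num)
    exact ((longOp A μ J wo).comp_memLp' ih).add ((combineOp A ∘L stepOp μ).comp_memLp' hs2)

theorem sq_norm_add_le {E : Type*} [NormedAddCommGroup E] (u v : E) {η : ℝ} (hη : 0 < η) :
    ‖u + v‖ ^ 2 ≤ (1 + η) * ‖u‖ ^ 2 + (1 + 1 / η) * ‖v‖ ^ 2 := by
  have h1 : ‖u + v‖ ^ 2 ≤ (‖u‖ + ‖v‖) ^ 2 := pow_le_pow_left₀ (norm_nonneg _) (norm_add_le u v) 2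
  have h2 : 0 ≤ (η * ‖u‖ - ‖v‖) ^ 2 / η := by positivity
  have h3 : (η * ‖u‖ - ‖v‖) ^ 2 / η = η * ‖u‖ ^ 2 + 1 / η * ‖v‖ ^ 2 - 2 * (‖u‖ * ‖v‖) := by
    field_simp; ring
  nlinarith

/-- Recursion for the mean-square distance between the error and its long-term model. -/
theorem integral_netError_sub_longError_sq_succ_le (hnoise : IsGradientNoise P F J wo ghat α σ)
    (hg : ∀ k, Differentiable ℝ (gradient (J k))) (hwo : combineOp A wo = wo)
    (hb : ErrorBounds R A μ J wo κ c K t) (hκ : 0 ≤ κ) (hc : 0 < c) (hc1 : c ≤ 1) (hK : 0 < K)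
    (ht : 0 < t) (ht1 : t ≤ 1) (hW : StronglyMeasurable[F 0] W₀) (hW4 : MemLp W₀ 4 P)
    (hL : MemLp L₀ 2 P) (n : ℕ) :
    ∫ ω, ‖R (netError A μ wo ghat W₀ (n + 1) ω -
        longError A μ J wo ghat W₀ L₀ (n + 1) ω)‖ ^ 2 ∂P ≤
      (1 - c * t / 2) * ∫ ω, ‖R (netError A μ wo ghat W₀ n ω -
        longError A μ J wo ghat W₀ L₀ n ω)‖ ^ 2 ∂P +
      3 / c * (K ^ 3 * κ) ^ 2 * t * ∫ ω, ‖R (netError A μ wo ghat W₀ n ω)‖ ^ 4 ∂P := by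
  have hD : ∀ n, Integrable (fun ω => ‖R (netError A μ wo ghat W₀ n ω -
      longError A μ J wo ghat W₀ L₀ n ω)‖ ^ 2) P := by
    intro n
    have h1 := (stronglyMeasurable_netError_and_memLp (A := A) hnoise hg hwo hb.norm_errorStep
      hW hW4 n).2.mono_exponent (p := 2) (by norm_num)
    have h2 := memLp_longError (A := A) hnoise hg hwo hb.norm_errorStep hW hW4 hL n
    have := (R.comp_memLp' (h1.sub h2)).integrable_norm_pow (by norm_num)
    simpa using this
  have hX : Integrable (fun ω => ‖R (netError A μ wo ghat W₀ n ω)‖ ^ 4) P :=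
    (R.comp_memLp' (stronglyMeasurable_netError_and_memLp (A := A) hnoise hg hwo hb.norm_errorStep
      hW hW4 n).2).integrable_norm_pow_four
  have hct : c * t ≤ 1 := mul_le_one₀ hc1 ht.le ht1
  have hct0 : 0 < c * t := by positivity
  rw [← integral_const_mul, ← integral_const_mul, ← integral_add ((hD n).const_mul _)
    (hX.const_mul _)]
  refine integral_mono (hD (n + 1)) (((hD n).const_mul _).add (hX.const_mul _)) fun ω => ?_
  simp only [netError_sub_longError_succ hwo μ J]
  set x := netError A μ wo ghat W₀ n ω
  set D := x - longError A μ J wo ghat W₀ L₀ n ω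
  rw [map_add]
  refine (sq_norm_add_le _ _ (half_pos hct0)).trans (add_le_add ?_ ?_)
  · calc (1 + c * t / 2) * ‖R (longOp A μ J wo D)‖ ^ 2
        ≤ (1 + c * t / 2) * ((1 - c * t) * ‖R D‖ ^ 2) := by
          gcongr
          exact hb.contract_long D
      _ = ((1 + c * t / 2) * (1 - c * t)) * ‖R D‖ ^ 2 := by ring
      _ ≤ _ := by
        gcongr
        nlinarith
  · have h1 : ‖R (combineOp A (stepOp μ (netGradient J (wo - x) + netHessian J wo x)))‖
        ≤ K ^ 3 * κ * t * ‖R x‖ ^ 2 := by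
      calc _ ≤ K * t * ‖netGradient J (wo - x) + netHessian J wo x‖ := hb.noise _
        _ ≤ K * t * (κ * (K * ‖R x‖) ^ 2) := by
          gcongr
          refine (hb.taylor x).trans ?_
          gcongr
          exact hb.lower x
        _ = _ := by ring
    -- The squared forcing is of order `t²`; Young's constant, of order `1 / t`, reduces it to `t`.
    calc (1 + 1 / (c * t / 2)) * _ ^ 2
        ≤ (1 + 1 / (c * t / 2)) * (K ^ 3 * κ * t * ‖R x‖ ^ 2) ^ 2 := by gcongr
      _ = (c * t + 2) * (1 / c * (K ^ 3 * κ) ^ 2 * t * ‖R x‖ ^ 4) := by field_simp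
      _ ≤ 3 * (1 / c * (K ^ 3 * κ) ^ 2 * t * ‖R x‖ ^ 4) := by
        gcongr
        linarith
      _ = _ := by ring

end Stochastic

/-! ### Scalar recursions and passage to the limit -/

theorem le_of_linear_recursion {f : ℕ → ℝ} {q r : ℝ} (hq : 0 < q) (hq1 : q ≤ 1)
    (h : ∀ n, f (n + 1) ≤ (1 - q) * f n + r) (n : ℕ) :
    f n ≤ (1 - q) ^ n * (f 0 - r / q) + r / q := by
  induction n with
  | zero => simp
  | succ n ih =>
    calc f (n + 1) ≤ (1 - q) * f n + r := h n
      _ ≤ (1 - q) * ((1 - q) ^ n * (f 0 - r / q) + r / q) + r := by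
        have : 0 ≤ 1 - q := by linarith
        gcongr
      _ = _ := by field_simp; ring

/-- Two coupled linear recursions: `e` settles at order `t²`, hence so does `d`. -/
theorem exists_le_of_coupled_recursion {d e : ℕ → ℝ} {c t a b Q : ℝ} (hc : 0 < c) (hc1 : c ≤ 1)
    (ht : 0 < t) (ht1 : t ≤ 1) (hQ : 0 ≤ Q) (ha : a * t ≤ c / 4)
    (he0 : ∀ n, 0 ≤ e n) (hd0 : ∀ n, 0 ≤ d n)
    (he : ∀ n, e (n + 1) ≤ (1 - c * t / 2) * e n + a * t ^ 3 * e n + b * t ^ 3)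
    (hd : ∀ n, d (n + 1) ≤ (1 - c * t / 2) * d n + Q * t * e n) :
    ∃ C₀, ∀ n, d n ≤ (1 - c * t / 8) ^ n * C₀ + 64 * Q * b / c ^ 2 * t ^ 2 := by
  have hct : c * t ≤ 1 := mul_le_one₀ hc1 ht.le ht1
  have hct0 : 0 < c * t := by positivity
  -- In the Lyapunov function `d + K e`, the decay `c t / 4` of `e` splits in two: `K c t / 8 = Q t`
  -- pays for the coupling, and the other `c t / 8` is the common rate.
  set K := 8 * Q / c with hK
  have hK0 : 0 ≤ K := by positivity
  have hKc : K * c = 8 * Q := by rw [hK]; field_simp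
  have hrec : ∀ n, (d (n + 1) + K * e (n + 1)) ≤
      (1 - c * t / 8) * (d n + K * e n) + K * b * t ^ 3 := by
    intro n
    have h1 : a * t ^ 3 * e n ≤ c / 4 * t * e n := by
      have : a * t ^ 3 ≤ c / 4 * t := by
        calc a * t ^ 3 = (a * t) * t * t := by ring
          _ ≤ c / 4 * t * 1 := by gcongr
          _ = _ := mul_one _
      exact mul_le_mul_of_nonneg_right this (he0 n)
    have h2 : K * e (n + 1) ≤ K * ((1 - c * t / 4) * e n + b * t ^ 3) := by
      refine mul_le_mul_of_nonneg_left ?_ hK0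
      linarith [he n]
    have h3 : Q * t * e n = K * (c * t / 8) * e n := by
      rw [show K * (c * t / 8) = (K * c) * t / 8 by ring, hKc]; ring
    have h4 : c * t / 8 * d n ≤ c * t / 2 * d n := by
      have := hd0 n
      gcongr
      norm_num
    linarith [hd n]
  have hq : c * t / 8 ≤ 1 := by linarith
  refine ⟨d 0 + K * e 0 - K * b * t ^ 3 / (c * t / 8), fun n => ?_⟩
  have := le_of_linear_recursion (f := fun n => d n + K * e n) (by positivity) hq hrec n
  have h5 : K * b * t ^ 3 / (c * t / 8) = 64 * Q * b / c ^ 2 * t ^ 2 := by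
    rw [hK]; field_simp; ring
  have h6 : 0 ≤ K * e n := mul_nonneg hK0 (he0 n)
  rw [← h5]
  linarith

/-- Square integrability identifies the Bochner integral with the extended one, so the real bound
carries over; the geometric term then vanishes. -/
theorem limsup_lintegral_le_of_integral_le {Ω E : Type*} {mΩ : MeasurableSpace Ω} {P : Measure Ω}
    [NormedAddCommGroup E] {f : ℕ → Ω → E} (hf : ∀ n, MemLp (f n) 2 P) {q C₀ B : ℝ} (hq : 0 < q)
    (hq1 : q ≤ 1) (h : ∀ n, ∫ ω, ‖f n ω‖ ^ 2 ∂P ≤ (1 - q) ^ n * C₀ + B) :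
    limsup (fun n => ∫⁻ ω, ‖f n ω‖ₑ ^ 2 ∂P) atTop ≤ ENNReal.ofReal B := by
  have hle : ∀ n, ∫⁻ ω, ‖f n ω‖ₑ ^ 2 ∂P ≤ ENNReal.ofReal ((1 - q) ^ n * C₀ + B) := by
    intro n
    have hI : Integrable (fun ω => ‖f n ω‖ ^ 2) P := by
      simpa using (hf n).integrable_norm_pow (by norm_num)
    calc ∫⁻ ω, ‖f n ω‖ₑ ^ 2 ∂P = ∫⁻ ω, ENNReal.ofReal (‖f n ω‖ ^ 2) ∂P := by
          simp only [ENNReal.ofReal_pow (norm_nonneg _), ofReal_norm]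
      _ = ENNReal.ofReal (∫ ω, ‖f n ω‖ ^ 2 ∂P) :=
          (ofReal_integral_eq_lintegral_ofReal hI (ae_of_all _ fun ω => by positivity)).symm
      _ ≤ _ := ENNReal.ofReal_le_ofReal (h n)
  have hlim : Tendsto (fun n : ℕ => ENNReal.ofReal ((1 - q) ^ n * C₀ + B)) atTop
      (𝓝 (ENNReal.ofReal B)) := by
    refine ENNReal.tendsto_ofReal ?_
    simpa using ((tendsto_pow_atTop_nhds_zero_of_lt_one (by linarith : 0 ≤ 1 - q)
      (by linarith)).mul_const C₀).add_const B
  exact (limsup_le_limsup (Eventually.of_forall hle)).trans hlim.limsup_eq.le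

end

end MultitaskDiffusion

theorem mainTheorem6 {N M G : ℕ}
    (graph : SimpleGraph (Fin N)) (group : Fin N → Fin G)
    (J : Fin N → MultitaskDiffusion.AgentSpace M → ℝ)
    (wo : MultitaskDiffusion.NetSpace N M)
    (A : Matrix (Fin N) (Fin N) ℝ)
    (lamL lamU : Fin N → ℝ) (κH α σ τ : ℝ)
    (hgroup : MultitaskDiffusion.IsGrouping graph group wo)
    (hA : MultitaskDiffusion.IsCombination graph group A)
    (hJ : MultitaskDiffusion.IsCostFamily group J wo lamL lamU κH)
    (hα : 0 ≤ α) (hσ : 0 ≤ σ) (hτ : 0 < τ) :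
    ∃ μ₀ : ℝ, 0 < μ₀ ∧ ∃ C : ℝ, 0 ≤ C ∧
      ∀ μ : Fin N → ℝ, (∀ k, 0 < μ k) →
        (∀ k, τ * MultitaskDiffusion.stepMax μ ≤ μ k) →
        MultitaskDiffusion.stepMax μ ≤ μ₀ →
        ∀ (Ω : Type*) [mΩ : MeasurableSpace Ω] (P : Measure Ω) [IsProbabilityMeasure P]
          (F : Filtration ℕ mΩ)
          (ghat : ℕ → Fin N → MultitaskDiffusion.AgentSpace M → Ω →
            MultitaskDiffusion.AgentSpace M),
          MultitaskDiffusion.IsGradientNoise P F J wo ghat α σ →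
          ∀ W₀ L₀ : Ω → MultitaskDiffusion.NetSpace N M,
            StronglyMeasurable[F 0] W₀ → MemLp W₀ 4 P → MemLp L₀ 2 P →
            limsup (fun n : ℕ => ∫⁻ ω,
                ‖MultitaskDiffusion.netError A μ wo ghat W₀ n ω
                  - MultitaskDiffusion.longError A μ J wo ghat W₀ L₀ n ω‖ₑ ^ 2 ∂P) atTop
              ≤ ENNReal.ofReal (C * MultitaskDiffusion.stepMax μ ^ 2) := by
  open MultitaskDiffusion in
  obtain ⟨R, c, K, t₀, hc, hc1, hK, ht₀, ht₀1, hbounds⟩ := exists_errorBounds hgroup hA hJ hτ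
  have hκ := hJ.κH_nonneg
  set a : ℝ := 35 * K ^ 4 / c * (α ^ 2 * K ^ 4) with ha
  set b : ℝ := 35 * K ^ 4 / c * σ ^ 4 with hb
  set Q : ℝ := 3 / c * (K ^ 3 * κH) ^ 2 with hQ
  have ha0 : 0 ≤ a := by positivity
  -- The second cap gives `a t ≤ c / 4`, so that the noise proportional to the error cannot spoil
  -- the contraction. The factor `K ^ 2` converts `‖R ·‖²` back to the Euclidean norm.
  refine ⟨min t₀ (c / 4 / (a + 1)), lt_min ht₀ (by positivity),
    K ^ 2 * (64 * Q * b / c ^ 2), by positivity, ?_⟩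
  intro μ hμ hτμ hμmax Ω mΩ P _ F ghat hnoise W₀ L₀ hW hW4 hL
  -- Without agents `stepMax μ` is the default value `0`, so `0 < t` fails; but the network space is
  -- then trivial.
  rcases Nat.eq_zero_or_pos N with rfl | hN
  · simp [Subsingleton.elim (_ : MultitaskDiffusion.NetSpace 0 M) 0]
  set t := MultitaskDiffusion.stepMax μ with ht_def
  have hμt : ∀ k, μ k ≤ t := le_ciSup (Set.finite_range μ).bddAbove
  have ht : 0 < t := (hμ ⟨0, hN⟩).trans_le (hμt ⟨0, hN⟩)
  have htt₀ : t ≤ t₀ := hμmax.trans (min_le_left _ _)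
  have ht1 : t ≤ 1 := htt₀.trans ht₀1
  have hat : a * t ≤ c / 4 := by
    calc a * t ≤ (a + 1) * (c / 4 / (a + 1)) := by
          gcongr
          · linarith
          · exact hμmax.trans (min_le_right _ _)
      _ = c / 4 := by field_simp
  have hB := hbounds μ t (fun k => (hμ k).le) hμt ht.le htt₀ hτμ
  have hg := hJ.differentiable_gradient
  have hwo := MultitaskDiffusion.combineOp_fixed hA hgroup
  obtain ⟨C₀, hC₀⟩ := MultitaskDiffusion.exists_le_of_coupled_recursion
    (d := fun n => ∫ ω, ‖R (MultitaskDiffusion.netError A μ wo ghat W₀ n ω -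
      MultitaskDiffusion.longError A μ J wo ghat W₀ L₀ n ω)‖ ^ 2 ∂P)
    (e := fun n => ∫ ω, ‖R (MultitaskDiffusion.netError A μ wo ghat W₀ n ω)‖ ^ 4 ∂P)
    (c := c) (t := t) (a := a) (b := b) (Q := Q) hc hc1 ht ht1 (by positivity) hat
    (fun n => integral_nonneg fun ω => by positivity)
    (fun n => integral_nonneg fun ω => by positivity)
    (fun n => (MultitaskDiffusion.integral_netError_pow_four_succ_le hnoise hg hwo hB hc hc1 hK
      ht ht1 hW hW4 n).trans (le_of_eq (by rw [ha, hb]; ring)))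
    (fun n => MultitaskDiffusion.integral_netError_sub_longError_sq_succ_le hnoise hg hwo hB hκ
      hc hc1 hK ht ht1 hW hW4 hL n)
  have hmem : ∀ n, MemLp (fun ω => MultitaskDiffusion.netError A μ wo ghat W₀ n ω -
      MultitaskDiffusion.longError A μ J wo ghat W₀ L₀ n ω) 2 P := fun n =>
    ((MultitaskDiffusion.stronglyMeasurable_netError_and_memLp hnoise hg hwo hB.norm_errorStep
      hW hW4 n).2.mono_exponent (by norm_num)).sub
    (MultitaskDiffusion.memLp_longError hnoise hg hwo hB.norm_errorStep hW hW4 hL n)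
  refine MultitaskDiffusion.limsup_lintegral_le_of_integral_le hmem (q := c * t / 8)
    (C₀ := K ^ 2 * C₀) (by positivity) (by linarith [mul_le_one₀ hc1 ht.le ht1]) fun n => ?_
  have hR := ((R.comp_memLp' (hmem n)).integrable_norm_pow (by norm_num)).const_mul (K ^ 2)
  have hI := (hmem n).integrable_norm_pow (by norm_num)
  calc ∫ ω, ‖MultitaskDiffusion.netError A μ wo ghat W₀ n ω -
        MultitaskDiffusion.longError A μ J wo ghat W₀ L₀ n ω‖ ^ 2 ∂P
      ≤ ∫ ω, K ^ 2 * ‖R (MultitaskDiffusion.netError A μ wo ghat W₀ n ω -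
        MultitaskDiffusion.longError A μ J wo ghat W₀ L₀ n ω)‖ ^ 2 ∂P := by
        refine integral_mono (by simpa using hI) (by simpa using hR) fun ω => ?_
        simp only [← mul_pow]
        exact pow_le_pow_left₀ (norm_nonneg _) (hB.lower _) 2
    _ = K ^ 2 * _ := integral_const_mul _ _
    _ ≤ K ^ 2 * ((1 - c * t / 8) ^ n * C₀ + 64 * Q * b / c ^ 2 * t ^ 2) := by
        gcongr
        exact hC₀ n
    _ = _ := by ring
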